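/- Let $\mathcal E,\omega,\mu>0$ and let $D\subset\mathbb R^2$ be a bounded, connected open set with $0\in D$, contained in the ball $\{\|z\|<\sqrt{2\mathcal E}/\omega\}$, whose boundary is a simple closed curve $\partial D=\gamma([0,L])$ with $\gamma\in C^1([0,L];\mathbb R^2)$, $\|\dot\gamma\|\equiv 1$, $\gamma(0)=\gamma(L)$ and $\gamma$ injective on $[0,L)$. Put $V_E(z)=\mathcal E-\frac{\omega^2}{2}\|z\|^2$ and $V_I(z)=\mathcal E+h+\frac{\mu}{\|z\|}$. *Outer arcs.* An outer arc from $\gamma(\xi_1)$ to $\gamma(\xi_2)$ is a curve $z:[0,T]\to\mathbb R^2$, $T>0$, with $z''=-\omega^2z$ and $\frac12\|z'\|^2=V_E(z)$ on $[0,T]$, $z(s)\notin D$ for $s\in(0,T)$, $z(0)=\gamma(\xi_1)$, $z(T)=\gamma(\xi_2)$. An interval $(a,b)\subset[0,L]$ has the outer-arc property if for all $\xi_1,\xi_2\in(a,b)$ there is exactly one outer arc (and exactly one $T$); $S_E(\xi_1,\xi_2)=\int_0^T\|z'\|\sqrt{V_E(z)}\,ds$ is its Jacobi length. *Inner arcs.*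 Two intervals $I,J\subset[0,L]$ (possibly equal) are not antipodal if for all $\xi_1\in I$, $\xi_2\in J$ the segment from $\gamma(\xi_1)$ to $\gamma(\xi_2)$ does not contain $0$. For $\xi_1\ne\xi_2$ a topologically non-trivial (TnT) inner arc from $\gamma(\xi_1)$ to $\gamma(\xi_2)$ is a curve $z:[0,T]\to\mathbb R^2\setminus\{0\}$, $T>0$, with $z''=-\mu z/\|z\|^3$ and $\frac12\|z'\|^2=V_I(z)$ on $[0,T]$, $z(s)\in D$ for $s\in(0,T)$, $z(0)=\gamma(\xi_1)$, $z(T)=\gamma(\xi_2)$, not homotopic (with fixed endpoints, in $\mathbb R^2\setminus\{0\}$) to the segment from $\gamma(\xi_1)$ to $\gamma(\xi_2)$. For $\xi_1=\xi_2=\xi$ the arc is understood in the Levi-Civita regularized sense: identifying $\mathbb R^2=\mathbb C$, $z(s(\tau))=w(\tau)^2$ with $s(\tau)=\int_0^\tau 2|w|^2$, where $w:[0,\bar\sigma]\to\mathbb C$, $\bar\sigma>0$, $s(\bar\sigma)=T$, satisfies $w''=2(\mathcal E+h)w$, $\frac12|w'|^2-(\mathcal E+h)|w|^2=\mu$, $w(0)^2=\gamma(\xi)$,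 $w(\bar\sigma)=-w(0)$, and $w(\tau)^2\in D$ for $\tau\in(0,\bar\sigma)$. Let $\mathcal A=\bigcup_{i=1}^m(a_i,b_i)$, and let $NA(i)$ be the set of $j$ such that $(a_i,b_i)$ and $(a_j,b_j)$ are not antipodal. $\mathcal A$ has the inner-arc property if $m\ge2$; the $(a_i,b_i)\subset[0,L]$ are nonempty, disjoint open intervals; for every $i$ one has $i\in NA(i)$ and there is $j\neq i$ with $j\in NA(i)$; and there is $h_0>0$ such that for all $i$, all $j\in NA(i)$, all $\xi_1\in(a_i,b_i)$, $\xi_2\in(a_j,b_j)$ and all $h>h_0$ there is exactly one TnT inner arc from $\gamma(\xi_1)$ to $\gamma(\xi_2)$. Its Jacobi length is $S_I(\xi_1,\xi_2;h)=\int_0^T\|z'\|\sqrt{V_I(z)}\,ds$. Assume that $\mathcal A$ has the inner-arc property, that each $(a_i,b_i)$ has the outer-arc property, and that $\mathcal A$ has the Euclidean change-sign property: there are $[\alpha_i,\beta_i]\subset(a_i,b_i)$, $\alpha_i<\beta_i$, $i=1,\dots,m$, such that $\cos(\sigma_i^-)\cos(\sigma_i^+)<0$ for every $i$, where $\sigma_i^-$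 (resp. $\sigma_i^+$) is the angle between $\gamma(\alpha_i)$ and $\dot\gamma(\alpha_i)$ (resp. $\gamma(\beta_i)$ and $\dot\gamma(\beta_i)$); equivalently, $\xi\mapsto\|\gamma(\xi)\|$ has derivatives of opposite strict sign at $\alpha_i$ and $\beta_i$. Then $\mathcal A$ has the change-sign property: there are $h_1\ge h_0$ (with $h_0$ a threshold as in the inner-arc property) and compact intervals $[\alpha_i,\beta_i]\subset(a_i,b_i)$, $\alpha_i<\beta_i$, $i=1,\dots,m$, such that for all $h>h_1$, all $i$, all $\xi_E\in[\alpha_i,\beta_i]$ and all $\xi_I\in\bigcup_{j\in NA(i)}[\alpha_j,\beta_j]$ the partial derivatives below exist and $$\big(\partial_bS_E(\xi_E,\alpha_i)+\partial_aS_I(\alpha_i,\xi_I;h)\big)\big(\partial_bS_E(\xi_E,\beta_i)+\partial_aS_I(\beta_i,\xi_I;h)\big)<0,$$ where $\partial_a$, $\partial_b$ are the partial derivatives with respect to the first and the second endpoint parameter. -/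

import Mathlib

open Set MeasureTheory

noncomputable section

/-- The Euclidean plane is identified with `ℂ`. The data of a Keplerian refraction billiard: an open
bounded domain `D` of the plane containing the origin and contained in the Hill region of the outer
potential, whose boundary is a simple closed curve parametrised by arc length by a `C¹` map `γ` on
`[0, L]`, together with the positive parameters of the two potentials. -/
structure RefractionBilliard where
  (ℰ ω μ L : ℝ)
  (D : Set ℂ)
  (γ : ℝ → ℂ)
  ℰ_pos : 0 < ℰ
  ω_pos : 0 < ω
  μ_pos : 0 < μ
  L_pos : 0 < L
  isOpen_D : IsOpen D
  isConnected_D : IsConnected D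
  isBounded_D : Bornology.IsBounded D
  zero_mem_D : (0 : ℂ) ∈ D
  D_subset_hill : D ⊆ Metric.ball 0 (√(2 * ℰ) / ω)
  contDiffOn_γ : ContDiffOn ℝ 1 γ (Icc 0 L)
  norm_deriv_γ : ∀ ξ ∈ Icc 0 L, ‖derivWithin γ (Icc 0 L) ξ‖ = 1
  γ_closed : γ 0 = γ L
  γ_simple : InjOn γ (Ico 0 L)
  frontier_D : frontier D = γ '' Icc 0 L

/-- There is exactly one arc `z : [0, T] → ℝ²` (for exactly one final time `T`) satisfying `P`;
functions that agree on `[0, T]` represent the same arc. -/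
def ExistsUniqueArc (P : ℝ → (ℝ → ℂ) → Prop) : Prop :=
  ∃ (T : ℝ) (z : ℝ → ℂ), P T z ∧
    ∀ (T' : ℝ) (z' : ℝ → ℂ), P T' z' → T' = T ∧ EqOn z' z (Icc 0 T)

/-- The Jacobi length `∫₀ᵀ ‖z'(s)‖ √(V(z(s))) ds`. -/
def jacobiLength (V : ℂ → ℝ) (T : ℝ) (z : ℝ → ℂ) : ℝ :=
  ∫ s in (0 : ℝ)..T, ‖deriv z s‖ * √(V (z s))

open Classical in
/-- The Jacobi length of the arc described by `P` (used when there is exactly one such arc). -/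
def lengthOfArc (V : ℂ → ℝ) (P : ℝ → (ℝ → ℂ) → Prop) : ℝ :=
  if hP : ∃ p : ℝ × (ℝ → ℂ), P p.1 p.2 then jacobiLength V hP.choose.1 hP.choose.2 else 0

/-- A continuous curve `α : [0, A] → ℝ² ∖ {0}` which is not homotopic, with fixed endpoints and in
the punctured plane, to the line segment from `α 0` to `α A` (a segment that avoids the origin). -/
def TopologicallyNontrivial (α : ℝ → ℂ) (A : ℝ) : Prop :=
  ∃ (x y : {z : ℂ // z ≠ 0}) (p q : Path x y),
    (∀ t : unitInterval, (p t : ℂ) = α (A * (t : ℝ))) ∧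
    (∀ t : unitInterval, (q t : ℂ) = AffineMap.lineMap (α 0) (α A) (t : ℝ)) ∧
    ¬ p.Homotopic q

namespace RefractionBilliard

variable (B : RefractionBilliard)

/-- The outer (harmonic) potential. -/
def VE (z : ℂ) : ℝ := B.ℰ - B.ω ^ 2 / 2 * ‖z‖ ^ 2

/-- The inner (Keplerian) potential. -/
def VI (h : ℝ) (z : ℂ) : ℝ := B.ℰ + h + B.μ / ‖z‖

/-- `z : [0, T] → ℝ²` is an outer arc from `γ ξ₁` to `γ ξ₂`. -/
def IsOuterArc (ξ₁ ξ₂ T : ℝ) (z : ℝ → ℂ) : Prop :=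
  0 < T ∧
  (∃ v : ℝ → ℂ, ∀ s ∈ Icc 0 T,
    HasDerivWithinAt z (v s) (Icc 0 T) s ∧
    HasDerivWithinAt v (-(B.ω ^ 2 • z s)) (Icc 0 T) s ∧
    1 / 2 * ‖v s‖ ^ 2 - B.ℰ + B.ω ^ 2 / 2 * ‖z s‖ ^ 2 = 0) ∧
  (∀ s ∈ Ioo 0 T, z s ∉ B.D) ∧
  z 0 = B.γ ξ₁ ∧ z T = B.γ ξ₂

/-- The interval `(a, b)` satisfies the outer-arc property. -/
def OuterArcProperty (a b : ℝ) : Prop :=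
  ∀ ξ₁ ∈ Ioo a b, ∀ ξ₂ ∈ Ioo a b, ExistsUniqueArc (B.IsOuterArc ξ₁ ξ₂)

/-- `z : [0, T] → ℝ²` is a classical solution of the inner fixed-ends problem, of Kepler energy
`ℰ + h`, from `γ ξ₁` to `γ ξ₂`. -/
def IsClassicalInnerArc (h ξ₁ ξ₂ T : ℝ) (z : ℝ → ℂ) : Prop :=
  0 < T ∧
  (∃ v : ℝ → ℂ, ∀ s ∈ Icc 0 T,
    HasDerivWithinAt z (v s) (Icc 0 T) s ∧
    HasDerivWithinAt v (-((B.μ / ‖z s‖ ^ 3) • z s)) (Icc 0 T) s ∧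
    1 / 2 * ‖v s‖ ^ 2 - B.ℰ - h - B.μ / ‖z s‖ = 0) ∧
  (∀ s ∈ Ioo 0 T, z s ∈ B.D) ∧
  z 0 = B.γ ξ₁ ∧ z T = B.γ ξ₂

/-- `z : [0, T] → ℝ²` is a topologically non-trivial solution, in the sense of the Levi-Civita
regularisation, of the inner fixed-ends problem from `γ ξ` back to itself. With `z = w²` and the new
time `τ` given by `ds = 2 ‖w‖² dτ`, the Kepler equation of energy `ℰ + h` becomes
`w'' = 2 (ℰ + h) w`, with conserved energy `‖w'‖² / 2 - (ℰ + h) ‖w‖² = μ`; non-triviality means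
that `w` joins the two different square roots of `γ ξ`. The curve `z` may pass through the origin,
as `w` may. -/
def IsRegularizedInnerArc (h ξ T : ℝ) (z : ℝ → ℂ) : Prop :=
  ∃ (σ : ℝ) (w : ℝ → ℂ), 0 < σ ∧
    (∃ u : ℝ → ℂ, ∀ τ ∈ Icc 0 σ,
      HasDerivWithinAt w (u τ) (Icc 0 σ) τ ∧
      HasDerivWithinAt u ((2 * (B.ℰ + h)) • w τ) (Icc 0 σ) τ ∧
      1 / 2 * ‖u τ‖ ^ 2 - (B.ℰ + h) * ‖w τ‖ ^ 2 = B.μ) ∧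
    T = ∫ r in (0 : ℝ)..σ, 2 * ‖w r‖ ^ 2 ∧
    (∀ τ ∈ Icc 0 σ, z (∫ r in (0 : ℝ)..τ, 2 * ‖w r‖ ^ 2) = w τ ^ 2) ∧
    (∀ τ ∈ Ioo 0 σ, w τ ^ 2 ∈ B.D) ∧
    w 0 ^ 2 = B.γ ξ ∧ w σ = -w 0

/-- `z : [0, T] → ℝ²` is a topologically non-trivial inner arc from `γ ξ₁` to `γ ξ₂`, understood in
the regularised sense when `ξ₁ = ξ₂`. -/
def IsInnerArc (h ξ₁ ξ₂ T : ℝ) (z : ℝ → ℂ) : Prop :=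
  (ξ₁ ≠ ξ₂ ∧ B.IsClassicalInnerArc h ξ₁ ξ₂ T z ∧ TopologicallyNontrivial z T) ∨
  (ξ₁ = ξ₂ ∧ B.IsRegularizedInnerArc h ξ₁ T z)

/-- The origin belongs to the segment joining `γ ξ₁` and `γ ξ₂`. -/
def Antipodal (ξ₁ ξ₂ : ℝ) : Prop := (0 : ℂ) ∈ segment ℝ (B.γ ξ₁) (B.γ ξ₂)

/-- The intervals `(a, b)` and `(c, d)` are not antipodal. -/
def NotAntipodal (a b c d : ℝ) : Prop :=
  ∀ ξ₁ ∈ Ioo a b, ∀ ξ₂ ∈ Ioo c d, ¬ B.Antipodal ξ₁ ξ₂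

/-- `NA(i)`: the indices of the intervals that are not antipodal to the `i`-th one. -/
def NA {m : ℕ} (a b : Fin m → ℝ) (i : Fin m) : Set (Fin m) :=
  {j | B.NotAntipodal (a i) (b i) (a j) (b j)}

/-- Existence and uniqueness of the topologically non-trivial inner arcs for all `h > h₀`. -/
def InnerArcsAbove {m : ℕ} (a b : Fin m → ℝ) (h₀ : ℝ) : Prop :=
  ∀ i, ∀ j ∈ B.NA a b i, ∀ ξ₁ ∈ Ioo (a i) (b i), ∀ ξ₂ ∈ Ioo (a j) (b j), ∀ h > h₀,
    ExistsUniqueArc (B.IsInnerArc h ξ₁ ξ₂)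

/-- The union of the intervals `(a i, b i)` satisfies the inner-arc property. -/
structure InnerArcProperty {m : ℕ} (a b : Fin m → ℝ) : Prop where
  two_le : 2 ≤ m
  lt : ∀ i, a i < b i
  subset : ∀ i, Ioo (a i) (b i) ⊆ Icc 0 B.L
  disjoint : ∀ i j, i ≠ j → Disjoint (Ioo (a i) (b i)) (Ioo (a j) (b j))
  not_antipodal : ∀ i, ∃ j, j ≠ i ∧ i ∈ B.NA a b i ∧ j ∈ B.NA a b i
  arcs : ∃ h₀ > 0, B.InnerArcsAbove a b h₀

/-- The Jacobi length of the outer arc from `γ ξ₁` to `γ ξ₂`. -/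
def SE (ξ₁ ξ₂ : ℝ) : ℝ := lengthOfArc B.VE (B.IsOuterArc ξ₁ ξ₂)

/-- The Jacobi length of the topologically non-trivial inner arc from `γ ξ₁` to `γ ξ₂`. -/
def SI (h ξ₁ ξ₂ : ℝ) : ℝ := lengthOfArc (B.VI h) (B.IsInnerArc h ξ₁ ξ₂)

/-- `∂_b S_E(ξE, ξ)`. -/
def dbSE (ξE ξ : ℝ) : ℝ := deriv (fun x => B.SE ξE x) ξ

/-- `∂_a S_I(ξ, ξI; h)`. -/
def daSI (h ξ ξI : ℝ) : ℝ := deriv (fun x => B.SI h x ξI) ξ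

/-- The partial derivatives `∂_b S_E(ξE, ξ)` and `∂_a S_I(ξ, ξI; h)` exist. -/
def HasPartials (h ξE ξI ξ : ℝ) : Prop :=
  DifferentiableAt ℝ (fun x => B.SE ξE x) ξ ∧ DifferentiableAt ℝ (fun x => B.SI h x ξI) ξ

/-- The (dynamical) change-sign property. The existence of the partial derivatives that occur in the
inequality is part of it. -/
def ChangeSignProperty {m : ℕ} (a b : Fin m → ℝ) : Prop :=
  B.InnerArcProperty a b ∧ (∀ i, B.OuterArcProperty (a i) (b i)) ∧
  ∃ h₀ > 0, B.InnerArcsAbove a b h₀ ∧ ∃ h₁ ≥ h₀, ∃ α β : Fin m → ℝ,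
    (∀ i, a i < α i ∧ α i < β i ∧ β i < b i) ∧
    ∀ h > h₁, ∀ i, ∀ ξE ∈ Icc (α i) (β i), ∀ j ∈ B.NA a b i, ∀ ξI ∈ Icc (α j) (β j),
      B.HasPartials h ξE ξI (α i) ∧ B.HasPartials h ξE ξI (β i) ∧
      (B.dbSE ξE (α i) + B.daSI h (α i) ξI) * (B.dbSE ξE (β i) + B.daSI h (β i) ξI) < 0

/-- The angle between the position vector `γ ξ` and the tangent vector to the boundary at `γ ξ`. -/
def tangentAngle (ξ : ℝ) : ℝ := InnerProductGeometry.angle (B.γ ξ) (deriv B.γ ξ)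

/-- The Euclidean change-sign property. -/
def EuclideanChangeSignProperty {m : ℕ} (a b : Fin m → ℝ) : Prop :=
  B.InnerArcProperty a b ∧ (∀ i, B.OuterArcProperty (a i) (b i)) ∧
  ∃ α β : Fin m → ℝ, (∀ i, a i < α i ∧ α i < β i ∧ β i < b i) ∧
    ∀ i, Real.cos (B.tangentAngle (α i)) * Real.cos (B.tangentAngle (β i)) < 0

end RefractionBilliard

end

open Filter Topology

/-! ### Primitives and linear flows on a compact interval -/

/-! For large `h` the inner term alone decides both signs. Inner side. The Levi-Civita map `z = w ^
2` turns a Kepler arc into a solution of `w'' = Ω ^ 2 w` with `Ω ^ 2 = 2 (ℰ + h)`. Its length is an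
explicit function of `‖γ ξ₁‖ + ‖γ ξ₂‖` and of the inner product of the endpoints of `w`, and
non-triviality makes that inner product negative (`innerArc_length`). The length is stationary in
the free duration, so its derivative has a closed form (`innerLength_hasDerivAt`). To leading order
as `Ω → ∞` it is `Ω / √2` times the derivative of `‖γ ξ‖`, uniformly when the other end runs over a
compact interval (`eventually_daSI_sign`).

Outer side. The derivative of `S_E` is the component of the final velocity along the unit tangent,
divided by `√2`, so the energy bounds it by `√ℰ`. The difficulty is its existence, because
uniqueness of arcs says nothing about regularity of the duration `T`. Three facts suffice. `T` is
continuous, by compactness and uniqueness, provided it does not collapse to `0`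
(`continuousAt_outerTime`). `cos (ω T)` solves a quadratic equation, whence `(T ξ - T ξ₀) ^ 2 = o(ξ
- ξ₀)` even at a double root (`hasDerivAt_sq_cos_sub`). The length is stationary in `T`
(`outerLength_hasDerivAt`). A collapse of `T` is conceivable only when both ends merge; there arcs
close to the radial one are constructed, and uniqueness identifies them with the given ones
(`exists_outerVelocity_near`). This requires that `γ'` be not parallel to `γ`.

That transversality is arranged by moving the parameters: intermediate values give points where `⟪γ,
γ'⟫ = ±ε`, with opposite signs and too small for `γ'` to be radial (`exists_transversal_pair`). -/

lemma exists_primitive_of_continuousOn {E : Type*} [NormedAddCommGroup E] [NormedSpace ℝ E]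
    [CompleteSpace E] {T : ℝ} (hT : 0 ≤ T) {f : ℝ → E} (hf : ContinuousOn f (Icc 0 T)) :
    ∃ F : ℝ → E, F 0 = 0 ∧ ∀ s ∈ Icc 0 T, HasDerivWithinAt F (f s) (Icc 0 T) s := by
  have hc : Continuous (IccExtend hT (domRestrict (Icc 0 T) f)) := by
    exact (continuousOn_iff_continuous_domRestrict.mp hf).Icc_extend'
  refine ⟨fun s => ∫ t in (0 : ℝ)..s, IccExtend hT (domRestrict (Icc 0 T) f) t, by simp, ?_⟩
  intro s hs
  have h := (hc.integral_hasStrictDerivAt 0 s).hasDerivAt.hasDerivWithinAt (s := Icc 0 T)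
  rwa [IccExtend_of_mem hT _ hs] at h

lemma eq_left_of_hasDerivWithinAt_zero {E : Type*} [NormedAddCommGroup E] [NormedSpace ℝ E]
    {T : ℝ} {f : ℝ → E} (hf : ∀ s ∈ Icc 0 T, HasDerivWithinAt f 0 (Icc 0 T) s) :
    ∀ s ∈ Icc 0 T, f s = f 0 := by
  refine constant_of_derivWithin_zero (fun s hs => (hf s hs).differentiableWithinAt) ?_
  intro s hs
  exact (hf s (Ico_subset_Icc_self hs)).derivWithin
    (uniqueDiffOn_Icc (hs.1.trans_lt hs.2) s (Ico_subset_Icc_self hs))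

/-- A solution of `w'' = Ω² w` in the time `τ`. -/
lemma hyperbolic_flow {T Ω : ℝ} (hΩ : Ω ≠ 0) {τ τ' : ℝ → ℝ} {w u : ℝ → ℂ} (hτ0 : τ 0 = 0)
    (hτ : ∀ s ∈ Icc 0 T, HasDerivWithinAt τ (τ' s) (Icc 0 T) s)
    (hw : ∀ s ∈ Icc 0 T, HasDerivWithinAt w (τ' s • u s) (Icc 0 T) s)
    (hu : ∀ s ∈ Icc 0 T, HasDerivWithinAt u ((τ' s * Ω ^ 2) • w s) (Icc 0 T) s) :
    ∀ s ∈ Icc 0 T,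
      w s = Real.cosh (Ω * τ s) • w 0 + (Real.sinh (Ω * τ s) / Ω) • u 0 ∧
      u s = (Ω * Real.sinh (Ω * τ s)) • w 0 + Real.cosh (Ω * τ s) • u 0 := by
  -- Flowing back from time `τ s` recovers the initial data, so this combination and the next are
  -- constants of motion.
  have h1 := eq_left_of_hasDerivWithinAt_zero
    (f := fun s => Real.cosh (Ω * τ s) • w s - (Real.sinh (Ω * τ s) / Ω) • u s) (T := T) (by
    intro s hs
    have hx := (hτ s hs).const_mul Ω
    refine ((hx.cosh.smul (hw s hs)).sub ((hx.sinh.div_const Ω).smul (hu s hs))).congr_deriv ?_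
    simp only [← smul_assoc, smul_eq_mul]
    match_scalars <;> (field_simp; ring))
  have h2 := eq_left_of_hasDerivWithinAt_zero
    (f := fun s => Real.cosh (Ω * τ s) • u s - (Ω * Real.sinh (Ω * τ s)) • w s) (T := T) (by
    intro s hs
    have hx := (hτ s hs).const_mul Ω
    refine ((hx.cosh.smul (hu s hs)).sub ((hx.sinh.const_mul Ω).smul (hw s hs))).congr_deriv ?_
    simp only [← smul_assoc, smul_eq_mul]
    match_scalars <;> (field_simp; ring))
  intro s hs
  have e1 := h1 s hs
  have e2 := h2 s hs
  have hcs := Real.cosh_sq (Ω * τ s)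
  simp only [hτ0, mul_zero, Real.cosh_zero, Real.sinh_zero, zero_div, zero_smul, sub_zero,
    one_smul] at e1 e2
  rw [← e1, ← e2]
  constructor
  · match_scalars
    · field_simp
      linear_combination (-1 : ℝ) * hcs
    · field_simp
      ring
  · match_scalars
    · field_simp
      linear_combination (-1 : ℝ) * hcs
    · field_simp
      ring

/-- A solution of `z'' = -ω² z`. -/
lemma harmonic_flow {T ω : ℝ} (hω : ω ≠ 0) {z v : ℝ → ℂ}
    (hz : ∀ s ∈ Icc 0 T, HasDerivWithinAt z (v s) (Icc 0 T) s)
    (hv : ∀ s ∈ Icc 0 T, HasDerivWithinAt v (-(ω ^ 2 • z s)) (Icc 0 T) s) :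
    ∀ s ∈ Icc 0 T,
      z s = Real.cos (ω * s) • z 0 + (Real.sin (ω * s) / ω) • v 0 ∧
      v s = (-(ω * Real.sin (ω * s))) • z 0 + Real.cos (ω * s) • v 0 := by
  have h1 := eq_left_of_hasDerivWithinAt_zero
    (f := fun s => Real.cos (ω * s) • z s - (Real.sin (ω * s) / ω) • v s) (T := T) (by
    intro s hs
    have hx := (hasDerivWithinAt_id s (Icc 0 T)).const_mul ω
    refine ((hx.cos.smul (hz s hs)).sub ((hx.sin.div_const ω).smul (hv s hs))).congr_deriv ?_
    simp only [id, smul_neg, ← smul_assoc, smul_eq_mul]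
    match_scalars <;> (field_simp; ring))
  have h2 := eq_left_of_hasDerivWithinAt_zero
    (f := fun s => Real.cos (ω * s) • v s + (ω * Real.sin (ω * s)) • z s) (T := T) (by
    intro s hs
    have hx := (hasDerivWithinAt_id s (Icc 0 T)).const_mul ω
    refine ((hx.cos.smul (hv s hs)).add ((hx.sin.const_mul ω).smul (hz s hs))).congr_deriv ?_
    simp only [id, smul_neg, ← smul_assoc, smul_eq_mul]
    match_scalars <;> (field_simp; ring))
  intro s hs
  have e1 := h1 s hs
  have e2 := h2 s hs
  have hcs := Real.sin_sq_add_cos_sq (ω * s)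
  simp only [mul_zero, Real.cos_zero, Real.sin_zero, zero_div, zero_smul, sub_zero, add_zero,
    one_smul] at e1 e2
  rw [← e1, ← e2]
  constructor
  · match_scalars
    · field_simp
      linear_combination (-1 : ℝ) * hcs
    · field_simp
      ring
  · match_scalars
    · field_simp
      linear_combination (-1 : ℝ) * hcs
    · field_simp
      ring

/-! ### The length of a Levi-Civita arc -/

/-- The hyperbolic cosine of the (rescaled) Levi-Civita time between two points, in terms of
`A = ‖w₁‖² + ‖w₂‖²` and `B = ⟪w₁, w₂⟫`. -/
noncomputable def innerCosh (k A B : ℝ) : ℝ := (-B + √(B ^ 2 + k * (A + k))) / k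

/-- The Jacobi length of a Levi-Civita arc. -/
noncomputable def innerLength (Ω μ A B : ℝ) : ℝ :=
  √2 * (Ω / 2 * ((innerCosh (2 * μ / Ω ^ 2) A B * A - 2 * B) /
    √(innerCosh (2 * μ / Ω ^ 2) A B ^ 2 - 1)) +
    μ / Ω * Real.arcosh (innerCosh (2 * μ / Ω ^ 2) A B))

/-- The constant term `-(A + k)` is negative, so the roots have opposite signs and a positive one
must carry the plus sign. -/
lemma innerCosh_eq {k A B C : ℝ} (hk : 0 < k) (hA : 0 ≤ A) (hC : 0 < C)
    (h : k * C ^ 2 + 2 * B * C - (A + k) = 0) : C = innerCosh k A B := by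
  have h1 : 0 < k * C + 2 * B := by
    by_contra hn
    nlinarith [mul_nonneg hC.le (sub_nonneg.mpr (not_lt.mp hn))]
  have h2 : 0 < k * C + B := by nlinarith [mul_pos hk hC]
  have h3 : B ^ 2 + k * (A + k) = (k * C + B) ^ 2 := by linear_combination (-k) * h
  rw [innerCosh, h3, Real.sqrt_sq h2.le]
  field_simp
  ring

/-- `C` and `S` stand for `cosh` and `sinh` of the phase. Eliminating the velocities by means of the
flow and the energy shows that the duration and the boundary term of the action depend on the
endpoints alone. -/
lemma hyperbolic_boundary {Ω μ C S : ℝ} {w₁ w₂ u₁ u₂ : ℂ} (hΩ : 0 < Ω) (hS : 0 < S)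
    (hCS : C ^ 2 = S ^ 2 + 1)
    (hw : w₂ = C • w₁ + (S / Ω) • u₁) (hu : u₂ = (Ω * S) • w₁ + C • u₁)
    (hE : ‖u₁‖ ^ 2 = 2 * μ + Ω ^ 2 * ‖w₁‖ ^ 2) :
    2 * μ / Ω ^ 2 * C ^ 2 + 2 * inner ℝ w₁ w₂ * C
      - (‖w₁‖ ^ 2 + ‖w₂‖ ^ 2 + 2 * μ / Ω ^ 2) = 0 ∧
    inner ℝ w₂ u₂ - inner ℝ w₁ u₁ =
      Ω * ((C * (‖w₁‖ ^ 2 + ‖w₂‖ ^ 2) - 2 * inner ℝ w₁ w₂) / S) := by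
  have hB : inner ℝ w₁ w₂ = C * ‖w₁‖ ^ 2 + S / Ω * inner ℝ w₁ u₁ := by
    rw [hw, inner_add_right, real_inner_smul_right, real_inner_smul_right,
      real_inner_self_eq_norm_sq]
  have hn : ‖w₂‖ ^ 2 = C ^ 2 * ‖w₁‖ ^ 2 + 2 * C * (S / Ω) * inner ℝ w₁ u₁
      + (S / Ω) ^ 2 * ‖u₁‖ ^ 2 := by
    rw [hw, norm_add_sq_real, norm_smul, norm_smul, real_inner_smul_left, real_inner_smul_right,
      mul_pow, mul_pow, Real.norm_eq_abs, Real.norm_eq_abs, sq_abs, sq_abs]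
    ring
  have hwu : inner ℝ w₂ u₂ = C * Ω * S * ‖w₁‖ ^ 2 + (C ^ 2 + S ^ 2) * inner ℝ w₁ u₁
      + C * (S / Ω) * ‖u₁‖ ^ 2 := by
    rw [hw, hu]
    simp only [inner_add_left, inner_add_right, real_inner_smul_left, real_inner_smul_right,
      real_inner_self_eq_norm_sq, real_inner_comm w₁ u₁]
    field_simp
    ring
  rw [hwu, hn, hB, hE]
  generalize inner ℝ w₁ u₁ = b
  generalize ‖w₁‖ ^ 2 = a
  constructor
  · field_simp
    linear_combination (2 * μ + Ω ^ 2 * a) * hCS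
  · field_simp
    linear_combination (-C * Ω ^ 2 * a - S * Ω * b) * hCS

/-- By the energy relation the integrand is the derivative of `⟪w, u⟫ / 2 + μ τ`. The general time
change `τ` serves classical arcs in physical time as well as regularised ones, where `τ` is the
identity. -/
lemma hyperbolic_action {T Ω μ : ℝ} {τ τ' : ℝ → ℝ} {w u : ℝ → ℂ}
    (hT : 0 ≤ T) (hτ0 : τ 0 = 0) (hτc : ContinuousOn τ' (Icc 0 T))
    (hτ : ∀ s ∈ Icc 0 T, HasDerivWithinAt τ (τ' s) (Icc 0 T) s)
    (hw : ∀ s ∈ Icc 0 T, HasDerivWithinAt w (τ' s • u s) (Icc 0 T) s)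
    (hu : ∀ s ∈ Icc 0 T, HasDerivWithinAt u ((τ' s * Ω ^ 2) • w s) (Icc 0 T) s)
    (hE : ∀ s ∈ Icc 0 T, ‖u s‖ ^ 2 = 2 * μ + Ω ^ 2 * ‖w s‖ ^ 2) :
    ∫ s in (0 : ℝ)..T, τ' s * ‖u s‖ ^ 2 =
      (inner ℝ (w T) (u T) - inner ℝ (w 0) (u 0)) / 2 + μ * τ T := by
  have hF : ∀ s ∈ Icc 0 T, HasDerivWithinAt (fun s => inner ℝ (w s) (u s) / 2 + μ * τ s)
      (τ' s * ‖u s‖ ^ 2) (Icc 0 T) s := by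
    intro s hs
    refine ((((hw s hs).inner ℝ (hu s hs)).div_const 2).add ((hτ s hs).const_mul μ)).congr_deriv ?_
    rw [real_inner_smul_left, real_inner_smul_right, real_inner_self_eq_norm_sq,
      real_inner_self_eq_norm_sq]
    linear_combination (-(τ' s / 2)) * hE s hs
  rw [intervalIntegral.integral_eq_sub_of_hasDerivAt_of_le hT
    (fun s hs => (hF s hs).continuousWithinAt)
    (fun s hs => (hF s (Ioo_subset_Icc_self hs)).hasDerivAt (Icc_mem_nhds hs.1 hs.2))]
  · rw [hτ0]
    ring
  · refine ContinuousOn.intervalIntegrable_of_Icc hT (hτc.mul ?_)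
    exact (ContinuousOn.norm fun s hs => (hu s hs).continuousWithinAt).pow 2

/-- The action of a Levi-Civita arc depends only on its endpoints. -/
lemma hyperbolic_length {T Ω μ : ℝ} (hΩ : 0 < Ω) (hμ : 0 < μ) {τ τ' : ℝ → ℝ} {w u : ℝ → ℂ}
    (hT : 0 ≤ T) (hτ0 : τ 0 = 0) (hτT : 0 < τ T) (hτc : ContinuousOn τ' (Icc 0 T))
    (hτ : ∀ s ∈ Icc 0 T, HasDerivWithinAt τ (τ' s) (Icc 0 T) s)
    (hw : ∀ s ∈ Icc 0 T, HasDerivWithinAt w (τ' s • u s) (Icc 0 T) s)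
    (hu : ∀ s ∈ Icc 0 T, HasDerivWithinAt u ((τ' s * Ω ^ 2) • w s) (Icc 0 T) s)
    (hE : ∀ s ∈ Icc 0 T, ‖u s‖ ^ 2 = 2 * μ + Ω ^ 2 * ‖w s‖ ^ 2) :
    √2 * ∫ s in (0 : ℝ)..T, τ' s * ‖u s‖ ^ 2 =
      innerLength Ω μ (‖w 0‖ ^ 2 + ‖w T‖ ^ 2) (inner ℝ (w 0) (w T)) := by
  rw [hyperbolic_action hT hτ0 hτc hτ hw hu hE]
  obtain ⟨e1, e2⟩ := hyperbolic_flow hΩ.ne' hτ0 hτ hw hu T (right_mem_Icc.mpr hT)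
  have hS : 0 < Real.sinh (Ω * τ T) := Real.sinh_pos_iff.mpr (mul_pos hΩ hτT)
  obtain ⟨h1, h2⟩ := hyperbolic_boundary hΩ hS (Real.cosh_sq _) e1 e2 (hE 0 (left_mem_Icc.mpr hT))
  have hC := innerCosh_eq (by positivity) (by positivity) (Real.cosh_pos _) h1
  rw [innerLength, ← hC, h2, Real.arcosh_cosh (mul_pos hΩ hτT).le,
    show Real.cosh (Ω * τ T) ^ 2 - 1 = Real.sinh (Ω * τ T) ^ 2 by
      rw [Real.cosh_sq]; ring, Real.sqrt_sq hS.le]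
  field_simp

/-! ### Classical arcs -/

/-- Both paths lie in one open half-plane, which is convex and misses the origin, so the
straight-line homotopy is admissible. -/
lemma homotopic_of_inner_pos {x y : {z : ℂ // z ≠ 0}} (p q : Path x y) (n : ℂ)
    (hp : ∀ t, 0 < inner ℝ (p t : ℂ) n) (hq : ∀ t, 0 < inner ℝ (q t : ℂ) n) : p.Homotopic q := by
  have hne : ∀ st : unitInterval × unitInterval,
      ((1 - (st.1 : ℝ)) • (p st.2 : ℂ) + (st.1 : ℝ) • (q st.2 : ℂ)) ≠ 0 := by
    intro st h0
    have h := congrArg (fun z : ℂ => inner ℝ z n) h0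
    simp only [inner_add_left, real_inner_smul_left, inner_zero_left] at h
    have h1 := hp st.2
    have h2 := hq st.2
    have h3 := st.1.2.1
    have h4 := st.1.2.2
    rcases h3.eq_or_lt with h5 | h5
    · rw [← h5] at h
      linarith
    · nlinarith [mul_nonneg (sub_nonneg.mpr h4) h1.le, mul_pos h5 h2]
  refine ⟨{
    toFun := fun st => ⟨_, hne st⟩
    continuous_toFun := by
      refine Continuous.subtype_mk ?_ _
      fun_prop
    map_zero_left := fun t => by ext; simp
    map_one_left := fun t => by ext; simp
    prop' := ?_ }⟩
  rintro s t (rfl | rfl)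
  · ext
    simp only [ContinuousMap.coe_mk, Path.source, Path.coe_toContinuousMap]
    module
  · ext
    simp only [ContinuousMap.coe_mk, Path.target, Path.coe_toContinuousMap]
    module

/-- Half-angle formula: square roots halve the angle up to a sign, so only the square of the inner
product is determined. -/
lemma inner_sq_of_sq {w₁ w₂ p q : ℂ} (h₁ : w₁ ^ 2 = p) (h₂ : w₂ ^ 2 = q) :
    inner ℝ w₁ w₂ ^ 2 = (‖p‖ * ‖q‖ + inner ℝ p q) / 2 := by
  subst h₁ h₂
  rw [norm_pow, norm_pow, ← Complex.normSq_eq_norm_sq, ← Complex.normSq_eq_norm_sq]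
  simp only [Complex.inner, Complex.normSq_apply, Complex.mul_re, Complex.conj_re, Complex.conj_im,
    pow_two, Complex.mul_im]
  ring

/-- Equality in Cauchy–Schwarz with this sign means opposite vectors, whose segment contains the
origin. -/
lemma norm_mul_norm_add_inner_pos {p q : ℂ} (hp : p ≠ 0) (hq : q ≠ 0)
    (h : (0 : ℂ) ∉ segment ℝ p q) : 0 < ‖p‖ * ‖q‖ + inner ℝ p q := by
  have h1 := (abs_le.mp (abs_real_inner_le_norm p q)).1
  refine lt_of_le_of_ne (by linarith) fun h0 => h ?_
  have h2 : inner ℝ p q = -(‖p‖ * ‖q‖) := by linarith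
  rw [InnerProductGeometry.inner_eq_neg_mul_norm_iff_angle_eq_pi hp hq,
    InnerProductGeometry.angle_eq_pi_iff] at h2
  obtain ⟨-, r, hr, rfl⟩ := h2
  have h1r : 0 < 1 - r := by linarith
  refine ⟨-r / (1 - r), 1 / (1 - r), div_nonneg (by linarith) h1r.le, by positivity, ?_, ?_⟩
  · field_simp
    ring
  · match_scalars
    field_simp
    ring

lemma inner_sq_mul (w₁ w₂ : ℂ) : inner ℝ (w₁ ^ 2) (w₁ * w₂) = ‖w₁‖ ^ 2 * inner ℝ w₁ w₂ := by
  rw [← Complex.normSq_eq_norm_sq]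
  simp only [Complex.inner, Complex.normSq_apply, Complex.mul_re, Complex.conj_re, Complex.conj_im,
    pow_two, Complex.mul_im]
  ring

/-- When the angle between `w₁` and `w₂` is acute, `w₁ * w₂` points along the bisector of their
squares, so every term of the expanded square has non-negative product with it. -/
lemma inner_sq_cone_pos {w₁ w₂ : ℂ} (h : 0 < inner ℝ w₁ w₂) {a b : ℝ} (ha : 0 ≤ a) (hb : 0 ≤ b)
    (hab : 0 < a + b) : 0 < inner ℝ ((a • w₁ + b • w₂) ^ 2) (w₁ * w₂) := by
  have h1 : w₁ ≠ 0 := by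
    rintro rfl
    simp at h
  have h2 : w₂ ≠ 0 := by
    rintro rfl
    simp at h
  have e : (a • w₁ + b • w₂) ^ 2 = a ^ 2 • w₁ ^ 2 + b ^ 2 • w₂ ^ 2 + (2 * a * b) • (w₁ * w₂) := by
    simp only [Complex.real_smul]
    push_cast
    ring
  have e2 : inner ℝ (w₂ ^ 2) (w₁ * w₂) = ‖w₂‖ ^ 2 * inner ℝ w₁ w₂ := by
    rw [mul_comm w₁, inner_sq_mul, real_inner_comm]
  rw [e, inner_add_left, inner_add_left, real_inner_smul_left, real_inner_smul_left,
    real_inner_smul_left, inner_sq_mul, e2, real_inner_self_eq_norm_sq]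
  have h3 := norm_pos_iff.mpr h1
  have h4 := norm_pos_iff.mpr h2
  rcases ha.eq_or_lt with rfl | ha'
  · have hb' : 0 < b := by linarith
    have : 0 < b ^ 2 * (‖w₂‖ ^ 2 * inner ℝ w₁ w₂) := by positivity
    simpa using this
  · have : 0 < a ^ 2 * (‖w₁‖ ^ 2 * inner ℝ w₁ w₂) := by positivity
    have : 0 ≤ b ^ 2 * (‖w₂‖ ^ 2 * inner ℝ w₁ w₂) := by positivity
    have : 0 ≤ 2 * a * b * ‖w₁ * w₂‖ ^ 2 := by positivity
    linarith

/-- The Levi-Civita transform of a collisionless Kepler arc. -/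
lemma exists_leviCivita {T μ H : ℝ} (hT : 0 ≤ T) {z v : ℝ → ℂ} (hz0 : ∀ s ∈ Icc 0 T, z s ≠ 0)
    (hz : ∀ s ∈ Icc 0 T, HasDerivWithinAt z (v s) (Icc 0 T) s)
    (hv : ∀ s ∈ Icc 0 T, HasDerivWithinAt v (-((μ / ‖z s‖ ^ 3) • z s)) (Icc 0 T) s)
    (hE : ∀ s ∈ Icc 0 T, 1 / 2 * ‖v s‖ ^ 2 = H + μ / ‖z s‖) :
    ∃ (τ : ℝ → ℝ) (w u : ℝ → ℂ), τ 0 = 0 ∧ (∀ s ∈ Icc 0 T, w s ^ 2 = z s) ∧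
      (∀ s ∈ Icc 0 T, HasDerivWithinAt τ (1 / (2 * ‖z s‖)) (Icc 0 T) s) ∧
      (∀ s ∈ Icc 0 T, HasDerivWithinAt w ((1 / (2 * ‖z s‖)) • u s) (Icc 0 T) s) ∧
      (∀ s ∈ Icc 0 T, HasDerivWithinAt u ((1 / (2 * ‖z s‖) * (2 * H)) • w s) (Icc 0 T) s) ∧
      ∀ s ∈ Icc 0 T, ‖u s‖ ^ 2 = ‖z s‖ * ‖v s‖ ^ 2 := by
  have hzc : ContinuousOn z (Icc 0 T) := fun s hs => (hz s hs).continuousWithinAt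
  have hvc : ContinuousOn v (Icc 0 T) := fun s hs => (hv s hs).continuousWithinAt
  obtain ⟨τ, hτ0, hτ⟩ := exists_primitive_of_continuousOn (f := fun s => 1 / (2 * ‖z s‖)) hT
    (continuousOn_const.div (hzc.norm.const_mul 2) fun s hs => by
      simpa using hz0 s hs)
  obtain ⟨I, hI0, hI⟩ := exists_primitive_of_continuousOn (f := fun s => v s / z s) hT
    (hvc.div hzc hz0)
  obtain ⟨w₀, hw₀⟩ := IsAlgClosed.exists_pow_nat_eq (z 0) (n := 2) (by norm_num)
  -- Integrating the logarithmic derivative `v / z` gives a continuous square root of `z` without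
  -- choosing a branch.
  set w : ℝ → ℂ := fun s => w₀ * Complex.exp (I s / 2) with hwdef
  have hw2 : ∀ s ∈ Icc 0 T, w s ^ 2 = z s := by
    have h := eq_left_of_hasDerivWithinAt_zero (f := fun s => w s ^ 2 / z s) (T := T) (by
      intro s hs
      have h1 : HasDerivWithinAt (fun s => w s ^ 2) (w s ^ 2 * (v s / z s)) (Icc 0 T) s := by
        refine ((((hI s hs).div_const 2).cexp.const_mul w₀).pow 2).congr_deriv ?_
        simp only [hwdef]
        ring
      refine (h1.div (hz s hs) (hz0 s hs)).congr_deriv ?_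
      have := hz0 s hs
      field_simp
      ring)
    intro s hs
    have h1 := h s hs
    have h00 := hz0 0 (left_mem_Icc.mpr hT)
    have h0 : w 0 ^ 2 / z 0 = 1 := by
      rw [div_eq_one_iff_eq h00, ← hw₀]
      simp [hwdef, hI0]
    rw [h0, div_eq_one_iff_eq (hz0 s hs)] at h1
    exact h1
  have hwne : ∀ s ∈ Icc 0 T, w s ≠ 0 := fun s hs h0 => hz0 s hs (by rw [← hw2 s hs, h0]; simp)
  have hwn : ∀ s ∈ Icc 0 T, (‖z s‖ : ℂ) = w s * star (w s) := by
    intro s hs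
    rw [← hw2 s hs, norm_pow, Complex.star_def, Complex.mul_conj, Complex.normSq_eq_norm_sq]
  have hw' : ∀ s ∈ Icc 0 T,
      HasDerivWithinAt w ((1 / (2 * ‖z s‖)) • (v s * star (w s))) (Icc 0 T) s := by
    intro s hs
    refine (((hI s hs).div_const 2).cexp.const_mul w₀).congr_deriv ?_
    have h0 := hwne s hs
    have h0' : star (w s) ≠ 0 := star_ne_zero.mpr h0
    rw [Complex.real_smul]
    push_cast
    rw [hwn s hs, ← hw2 s hs]
    change w₀ * (Complex.exp (I s / 2) * _) = _
    rw [← mul_assoc]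
    change w s * _ = _
    field_simp
  clear_value w
  -- `v * star w` is the derivative of `w` in the Levi-Civita time.
  refine ⟨τ, w, fun s => v s * star (w s), hτ0, hw2, hτ, hw', ?_, ?_⟩
  · intro s hs
    refine ((hv s hs).mul (hw' s hs).star).congr_deriv ?_
    have h0 := hwne s hs
    have h0' : star (w s) ≠ 0 := star_ne_zero.mpr h0
    have hEs : (1 / 2 * (v s * star (v s)) : ℂ) = H + μ / (w s * star (w s)) := by
      rw [← hwn s hs, Complex.star_def, Complex.mul_conj, Complex.normSq_eq_norm_sq]
      have h1 := congrArg (fun r : ℝ => (r : ℂ)) (hE s hs)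
      push_cast at h1 ⊢
      exact h1
    rw [star_smul, star_mul, star_star]
    simp only [Complex.real_smul, star_trivial]
    push_cast
    rw [hwn s hs, ← hw2 s hs]
    have hEs' : (2 * H : ℂ) = v s * star (v s) - 2 * μ / (w s * star (w s)) := by
      linear_combination (-2 : ℂ) * hEs
    rw [hEs']
    field_simp
    ring
  · intro s hs
    rw [norm_mul, norm_star, mul_pow, ← hw2 s hs, norm_pow]
    ring

namespace RefractionBilliard

variable (B : RefractionBilliard)

/-- The Levi-Civita frequency at energy `ℰ + h`. -/
noncomputable def lcFreq (h : ℝ) : ℝ := √(2 * (B.ℰ + h))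

/-- The inner product of the Levi-Civita endpoints of a topologically non-trivial arc. -/
noncomputable def lcInner (ξ₁ ξ₂ : ℝ) : ℝ := -√((‖B.γ ξ₁‖ * ‖B.γ ξ₂‖ + inner ℝ (B.γ ξ₁) (B.γ ξ₂)) / 2)

/-- The endpoints determine the inner product of `w 0` and `w T` up to sign. Were it positive, `w`
would stay in the cone spanned by `w 0` and `w T`, so `z` and the segment would share a half-plane
and be homotopic. -/
lemma classicalInnerArc_length {h ξ₁ ξ₂ T : ℝ} {z : ℝ → ℂ} (hh : 0 < B.ℰ + h)
    (hz : B.IsClassicalInnerArc h ξ₁ ξ₂ T z) (hnt : TopologicallyNontrivial z T)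
    (hna : ¬ B.Antipodal ξ₁ ξ₂) :
    jacobiLength (B.VI h) T z =
      innerLength (B.lcFreq h) B.μ (‖B.γ ξ₁‖ + ‖B.γ ξ₂‖) (B.lcInner ξ₁ ξ₂) := by
  obtain ⟨hT, ⟨v, hv⟩, -, hz1, hz2⟩ := hz
  obtain ⟨x, y, P, Q, hP, hQ, hPQ⟩ := hnt
  have hμ := B.μ_pos
  have hz0 : ∀ s ∈ Icc 0 T, z s ≠ 0 := by
    intro s hs
    have h1 := (P ⟨s / T, by
      constructor
      · exact div_nonneg hs.1 hT.le
      · exact (div_le_one hT).mpr hs.2⟩).2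
    rwa [hP, mul_div_cancel₀ _ hT.ne'] at h1
  have hE : ∀ s ∈ Icc 0 T, 1 / 2 * ‖v s‖ ^ 2 = (B.ℰ + h) + B.μ / ‖z s‖ := fun s hs => by
    linarith [(hv s hs).2.2]
  obtain ⟨τ, w, u, hτ0, hw2, hτ, hw, hu, hun⟩ := exists_leviCivita hT.le hz0
    (fun s hs => (hv s hs).1) (fun s hs => (hv s hs).2.1) hE
  have hzn : ∀ s ∈ Icc 0 T, 0 < ‖z s‖ := fun s hs => norm_pos_iff.mpr (hz0 s hs)
  have hzc : ContinuousOn z (Icc 0 T) := fun s hs => (hv s hs).1.continuousWithinAt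
  have hΩ : 0 < B.lcFreq h := Real.sqrt_pos.mpr (by linarith)
  have hΩ2 : B.lcFreq h ^ 2 = 2 * (B.ℰ + h) := Real.sq_sqrt (by linarith)
  have h0T : (0 : ℝ) ∈ Icc 0 T := left_mem_Icc.mpr hT.le
  have hTT : T ∈ Icc 0 T := right_mem_Icc.mpr hT.le
  have hτmono : StrictMonoOn τ (Icc 0 T) := by
    refine strictMonoOn_of_deriv_pos (convex_Icc 0 T)
      (fun s hs => (hτ s hs).continuousWithinAt) fun s hs => ?_
    rw [interior_Icc] at hs
    rw [((hτ s (Ioo_subset_Icc_self hs)).hasDerivAt (Icc_mem_nhds hs.1 hs.2)).deriv]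
    have := hzn s (Ioo_subset_Icc_self hs)
    positivity
  have hτT : 0 < τ T := by
    rw [← hτ0]
    exact hτmono h0T hTT hT
  have hτc : ContinuousOn (fun s => 1 / (2 * ‖z s‖)) (Icc 0 T) :=
    continuousOn_const.div (hzc.norm.const_mul 2) fun s hs => by simpa using hz0 s hs
  have hu' : ∀ s ∈ Icc 0 T, HasDerivWithinAt u ((1 / (2 * ‖z s‖) * B.lcFreq h ^ 2) • w s)
      (Icc 0 T) s := fun s hs => by
    rw [hΩ2]
    exact hu s hs
  have hEu : ∀ s ∈ Icc 0 T, ‖u s‖ ^ 2 = 2 * B.μ + B.lcFreq h ^ 2 * ‖w s‖ ^ 2 := by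
    intro s hs
    have h1 : ‖w s‖ ^ 2 = ‖z s‖ := by rw [← norm_pow, hw2 s hs]
    have h2 := hE s hs
    have h3 := hzn s hs
    rw [hun s hs, h1, hΩ2]
    field_simp at h2
    linear_combination h2
  have hlen := hyperbolic_length hΩ hμ hT.le hτ0 hτT hτc hτ hw hu' hEu
  have hw1 : w 0 ^ 2 = B.γ ξ₁ := by rw [hw2 0 h0T, hz1]
  have hw3 : w T ^ 2 = B.γ ξ₂ := by rw [hw2 T hTT, hz2]
  have hp : B.γ ξ₁ ≠ 0 := hz1 ▸ hz0 0 h0T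
  have hq : B.γ ξ₂ ≠ 0 := hz2 ▸ hz0 T hTT
  have hpq := norm_mul_norm_add_inner_pos hp hq hna
  have hsq := inner_sq_of_sq hw1 hw3
  have hneg : inner ℝ (w 0) (w T) < 0 := by
    by_contra hn
    have hpos : 0 < inner ℝ (w 0) (w T) := by
      refine lt_of_le_of_ne (not_lt.mp hn) fun h0 => ?_
      rw [← h0] at hsq
      linarith
    refine hPQ (homotopic_of_inner_pos P Q (w 0 * w T) ?_ ?_)
    · intro t
      have hs : T * (t : ℝ) ∈ Icc 0 T :=
        ⟨mul_nonneg hT.le t.2.1, mul_le_of_le_one_right hT.le t.2.2⟩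
      have hflow := hyperbolic_flow hΩ.ne' hτ0 hτ hw hu'
      have e1 := (hflow _ hs).1
      have e2 := (hflow T hTT).1
      rw [hP, ← hw2 _ hs]
      have hx0 : 0 ≤ τ (T * t) := hτ0 ▸ hτmono.monotoneOn h0T hs hs.1
      have hx1 : τ (T * t) ≤ τ T := hτmono.monotoneOn hs hTT hs.2
      have hS : 0 < Real.sinh (B.lcFreq h * τ T) := Real.sinh_pos_iff.mpr (mul_pos hΩ hτT)
      have ha : 0 ≤ Real.sinh (B.lcFreq h * τ T - B.lcFreq h * τ (T * t)) :=
        Real.sinh_nonneg_iff.mpr (by nlinarith)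
      have hb : 0 ≤ Real.sinh (B.lcFreq h * τ (T * t)) := Real.sinh_nonneg_iff.mpr (by positivity)
      -- Interpolation by `sinh` with non-negative weights puts `w` in the cone of its endpoints.
      have key : w (T * t) =
          (Real.sinh (B.lcFreq h * τ T - B.lcFreq h * τ (T * t)) /
            Real.sinh (B.lcFreq h * τ T)) • w 0 +
          (Real.sinh (B.lcFreq h * τ (T * t)) / Real.sinh (B.lcFreq h * τ T)) • w T := by
        rw [e1, e2, Real.sinh_sub]
        match_scalars <;> field_simp
        ring
      rw [key]
      refine inner_sq_cone_pos hpos (by positivity) (by positivity) ?_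
      have hne : w (T * t) ≠ 0 := fun h0 => hz0 _ hs (by rw [← hw2 _ hs, h0]; simp)
      refine lt_of_le_of_ne (by positivity) fun h0 => hne ?_
      have h1 := div_nonneg ha hS.le
      have h2 := div_nonneg hb hS.le
      rw [key, show Real.sinh (B.lcFreq h * τ T - B.lcFreq h * τ (T * t)) /
            Real.sinh (B.lcFreq h * τ T) = 0 by linarith,
          show Real.sinh (B.lcFreq h * τ (T * t)) / Real.sinh (B.lcFreq h * τ T) = 0 by linarith]
      simp
    · intro t
      have e2 : inner ℝ (w T ^ 2) (w 0 * w T) = ‖w T‖ ^ 2 * inner ℝ (w 0) (w T) := by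
        rw [mul_comm (w 0), inner_sq_mul, real_inner_comm]
      rw [hQ, AffineMap.lineMap_apply_module, hz1, hz2, ← hw1, ← hw3, inner_add_left,
        real_inner_smul_left, real_inner_smul_left, inner_sq_mul, e2, ← norm_pow, ← norm_pow,
        hw1, hw3]
      have h1 := mul_pos (norm_pos_iff.mpr hp) hpos
      have h2 := mul_pos (norm_pos_iff.mpr hq) hpos
      rcases t.2.1.eq_or_lt with h5 | h5
      · rw [← h5]
        linarith
      · nlinarith [mul_nonneg (sub_nonneg.mpr t.2.2) h1.le, mul_pos h5 h2]
  have hB : inner ℝ (w 0) (w T) = B.lcInner ξ₁ ξ₂ := by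
    rw [lcInner, ← hsq, Real.sqrt_sq_eq_abs, abs_of_neg hneg, neg_neg]
  rw [hB, ← norm_pow, ← norm_pow, hw1, hw3] at hlen
  rw [← hlen, jacobiLength, ← intervalIntegral.integral_const_mul]
  refine intervalIntegral.integral_congr_ae ?_
  have hae : ∀ᵐ s : ℝ, s ≠ T := by simp [ae_iff, measure_singleton]
  filter_upwards [hae] with s hsT hs
  rw [uIoc_of_le hT.le] at hs
  have hs' : s ∈ Ioo 0 T := ⟨hs.1, lt_of_le_of_ne hs.2 hsT⟩
  have hsI := Ioo_subset_Icc_self hs'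
  rw [((hv s hsI).1.hasDerivAt (Icc_mem_nhds hs'.1 hs'.2)).deriv, VI, ← hE s hsI, hun s hsI]
  have h3 := hzn s hsI
  rw [Real.sqrt_mul (by norm_num), Real.sqrt_sq (norm_nonneg _)]
  rw [Real.sqrt_div (by norm_num), Real.sqrt_one]
  have h2 : √2 ^ 2 = (2 : ℝ) := Real.sq_sqrt (by norm_num)
  field_simp
  linear_combination (-‖v s‖ ^ 2) * h2

end RefractionBilliard

/-! ### Regularised arcs and the common formula for the inner length -/

namespace RefractionBilliard

variable (B : RefractionBilliard)

/-- Here `w σ = -w 0` gives the inner product at once. The work lies in passing from physical time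
to `τ`, since the time change is degenerate at a collision. -/
lemma regularizedInnerArc_length {h ξ T : ℝ} {z : ℝ → ℂ} (hh : 0 < B.ℰ + h)
    (hz : B.IsRegularizedInnerArc h ξ T z) :
    jacobiLength (B.VI h) T z =
      innerLength (B.lcFreq h) B.μ (‖B.γ ξ‖ + ‖B.γ ξ‖) (B.lcInner ξ ξ) := by
  obtain ⟨σ, w, hσ, ⟨u, hu⟩, hT, hzw, -, hw0, hwσ⟩ := hz
  have hμ := B.μ_pos
  have hΩ : 0 < B.lcFreq h := Real.sqrt_pos.mpr (by linarith)
  have hΩ2 : B.lcFreq h ^ 2 = 2 * (B.ℰ + h) := Real.sq_sqrt (by linarith)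
  have hwc : ContinuousOn w (Icc 0 σ) := fun s hs => (hu s hs).1.continuousWithinAt
  have hE : ∀ s ∈ Icc 0 σ, ‖u s‖ ^ 2 = 2 * B.μ + B.lcFreq h ^ 2 * ‖w s‖ ^ 2 := fun s hs => by
    rw [hΩ2]
    linear_combination 2 * (hu s hs).2.2
  have hid : ∀ s ∈ Icc 0 σ, HasDerivWithinAt (fun s : ℝ => s) 1 (Icc 0 σ) s := fun s _ =>
    hasDerivWithinAt_id s _
  have hw' : ∀ s ∈ Icc 0 σ, HasDerivWithinAt w ((1 : ℝ) • u s) (Icc 0 σ) s := fun s hs => by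
    rw [one_smul]
    exact (hu s hs).1
  have hu' : ∀ s ∈ Icc 0 σ, HasDerivWithinAt u ((1 * B.lcFreq h ^ 2) • w s) (Icc 0 σ) s :=
    fun s hs => by
      rw [one_mul, hΩ2]
      exact (hu s hs).2.1
  have hlen := hyperbolic_length (τ := fun s => s) (τ' := fun _ => 1) hΩ hμ hσ.le rfl hσ
    continuousOn_const hid hw' hu' hE
  have hn : ‖w 0‖ ^ 2 = ‖B.γ ξ‖ := by rw [← norm_pow, hw0]
  have hB : inner ℝ (w 0) (w σ) = B.lcInner ξ ξ := by
    rw [lcInner, hwσ, inner_neg_right, real_inner_self_eq_norm_sq, real_inner_self_eq_norm_sq, hn,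
      show (‖B.γ ξ‖ * ‖B.γ ξ‖ + ‖B.γ ξ‖ ^ 2) / 2 = ‖B.γ ξ‖ ^ 2 by ring,
      Real.sqrt_sq (norm_nonneg _)]
  rw [hB, hwσ, norm_neg, hn] at hlen
  rw [← hlen]
  have hgc : ContinuousOn (fun r => 2 * ‖w r‖ ^ 2) (Icc 0 σ) := (hwc.norm.pow 2).const_mul 2
  obtain ⟨S, hS0, hS⟩ := exists_primitive_of_continuousOn hσ.le hgc
  have hSint : ∀ τ ∈ Icc 0 σ, ∫ r in (0 : ℝ)..τ, 2 * ‖w r‖ ^ 2 = S τ := by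
    intro τ hτ
    rw [intervalIntegral.integral_eq_sub_of_hasDerivAt_of_le hτ.1
      (fun s hs => ((hS s ⟨hs.1, hs.2.trans hτ.2⟩).continuousWithinAt).mono
        (Icc_subset_Icc_right hτ.2))
      (fun s hs => (hS s ⟨hs.1.le, hs.2.le.trans hτ.2⟩).hasDerivAt
        (Icc_mem_nhds hs.1 (hs.2.trans_le hτ.2))), hS0, sub_zero]
    exact (hgc.mono (Icc_subset_Icc_right hτ.2)).intervalIntegrable_of_Icc hτ.1
  -- Two zeros of `w` would force `w 0 = u 0 = 0`, against the energy `μ > 0`. A single collision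
  -- spoils neither the monotonicity of `S` nor the integral.
  have hwz : ∀ τ₁ ∈ Icc 0 σ, ∀ τ₂ ∈ Icc 0 σ, w τ₁ = 0 → w τ₂ = 0 → τ₁ = τ₂ := by
    intro x hx y hy hwx hwy
    by_contra hxy
    have hflow := hyperbolic_flow (τ := fun s => s) hΩ.ne' rfl hid hw' hu'
    have e1 := (hflow x hx).1
    have e2 := (hflow y hy).1
    rw [hwx] at e1
    rw [hwy] at e2
    have hne : Real.sinh (B.lcFreq h * y - B.lcFreq h * x) ≠ 0 := by
      rw [Ne, Real.sinh_eq_zero, ← mul_sub]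
      exact mul_ne_zero hΩ.ne' (sub_ne_zero.mpr (Ne.symm hxy))
    rw [Real.sinh_sub] at hne
    have h1 : w 0 = 0 := by
      refine (smul_eq_zero_iff_right hne).mp ?_
      linear_combination (norm := module) (Real.sinh (B.lcFreq h * x)) • e2 -
        (Real.sinh (B.lcFreq h * y)) • e1
    have h2 : u 0 = 0 := by
      rw [h1, smul_zero, zero_add] at e1 e2
      by_contra h0
      have h3 := (smul_eq_zero_iff_left h0).mp e1.symm
      have h4 := (smul_eq_zero_iff_left h0).mp e2.symm
      rw [div_eq_zero_iff, or_iff_left hΩ.ne'] at h3 h4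
      rw [h3, h4] at hne
      simp at hne
    have h3 := hE 0 (left_mem_Icc.mpr hσ.le)
    rw [h1, h2] at h3
    simp only [norm_zero] at h3
    nlinarith
  have hSmono : StrictMonoOn S (Icc 0 σ) := by
    intro x hx y hy hxy
    have hsub : Icc x y ⊆ Icc 0 σ := Icc_subset_Icc hx.1 hy.2
    have h1 : ∫ r in x..y, 2 * ‖w r‖ ^ 2 = S y - S x :=
      intervalIntegral.integral_eq_sub_of_hasDerivAt_of_le hxy.le
        (fun s hs => ((hS s (hsub hs)).continuousWithinAt).mono hsub)
        (fun s hs => (hS s (hsub (Ioo_subset_Icc_self hs))).hasDerivAt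
          (Icc_mem_nhds (hx.1.trans_lt hs.1) (hs.2.trans_le hy.2)))
        ((hgc.mono hsub).intervalIntegrable_of_Icc hxy.le)
    have h2 : 0 < ∫ r in x..y, 2 * ‖w r‖ ^ 2 := by
      refine intervalIntegral.integral_pos hxy (hgc.mono hsub) (fun r _ => by positivity) ?_
      by_cases h0 : w x = 0
      · refine ⟨y, right_mem_Icc.mpr hxy.le, ?_⟩
        have : w y ≠ 0 := fun h' => hxy.ne (hwz x hx y hy h0 h')
        positivity
      · exact ⟨x, left_mem_Icc.mpr hxy.le, by positivity⟩
    linarith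
  have hσσ : σ ∈ Icc 0 σ := right_mem_Icc.mpr hσ.le
  have hTS : T = S σ := by rw [hT, hSint σ hσσ]
  have hT0 : 0 ≤ T := by
    rw [hTS, ← hS0]
    exact hSmono.monotoneOn (left_mem_Icc.mpr hσ.le) hσσ hσ.le
  have himg : S '' Icc 0 σ = Icc 0 T := by
    refine Subset.antisymm ?_ ?_
    · rintro _ ⟨τ, hτ, rfl⟩
      rw [← hS0, hTS]
      exact ⟨hSmono.monotoneOn (left_mem_Icc.mpr hσ.le) hτ hτ.1,
        hSmono.monotoneOn hτ hσσ hτ.2⟩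
    · have := intermediate_value_Icc hσ.le (fun s hs => (hS s hs).continuousWithinAt)
      rwa [hS0, ← hTS] at this
  -- Change of variables `s = S τ`; the endpoints and the collision time form a null set.
  rw [jacobiLength, intervalIntegral.integral_of_le hT0, ← integral_Icc_eq_integral_Ioc, ← himg,
    integral_image_eq_integral_abs_deriv_smul measurableSet_Icc hS hSmono.injOn,
    ← intervalIntegral.integral_const_mul, intervalIntegral.integral_of_le hσ.le,
    ← integral_Icc_eq_integral_Ioc]
  refine setIntegral_congr_ae measurableSet_Icc ?_
  have hae1 : ∀ᵐ s : ℝ, s ≠ 0 := by simp [ae_iff, measure_singleton]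
  have hae2 : ∀ᵐ s : ℝ, s ≠ σ := by simp [ae_iff, measure_singleton]
  have hae3 : ∀ᵐ s : ℝ, ¬ (s ∈ Icc 0 σ ∧ w s = 0) := by
    have hsub : {s : ℝ | s ∈ Icc 0 σ ∧ w s = 0}.Subsingleton :=
      fun a ha b hb => hwz a ha.1 b hb.1 ha.2 hb.2
    rw [ae_iff]
    simpa only [not_not] using hsub.measure_zero volume
  filter_upwards [hae1, hae2, hae3] with s h0 h1 h2 hs
  have hws : w s ≠ 0 := fun h => h2 ⟨hs, h⟩
  have hs' : s ∈ Ioo 0 σ := ⟨lt_of_le_of_ne hs.1 (Ne.symm h0), lt_of_le_of_ne hs.2 h1⟩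
  have hnhds : Icc 0 σ ∈ 𝓝 s := Icc_mem_nhds hs'.1 hs'.2
  have hwp : 0 < ‖w s‖ := norm_pos_iff.mpr hws
  have hne : 2 * ‖w s‖ ^ 2 ≠ 0 := by positivity
  -- `z` is known only through `z (S τ) = w τ ^ 2`, so it is differentiated along a local inverse of
  -- `S`, which exists where `w s ≠ 0`.
  have hzd : deriv z (S s) = (2 * ‖w s‖ ^ 2)⁻¹ • (2 * w s * u s) := by
    have hstrict : HasStrictDerivAt S (2 * ‖w s‖ ^ 2) s :=
      hasStrictDerivAt_of_hasDerivAt_of_continuousAt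
        (by
          filter_upwards [Ioo_mem_nhds hs'.1 hs'.2] with r hr
          exact (hS r (Ioo_subset_Icc_self hr)).hasDerivAt (Icc_mem_nhds hr.1 hr.2))
        (hgc.continuousAt hnhds)
    have hinv := (hstrict.to_localInverse hne).hasDerivAt
    have hinvs : hstrict.localInverse S _ s hne (S s) = s :=
      (hstrict.eventually_left_inverse hne).self_of_nhds
    have hwd : HasDerivAt (fun r => w r ^ 2) (2 * w s * u s) s :=
      (((hu s hs).1.hasDerivAt hnhds).pow 2).congr_deriv (by ring)
    refine HasDerivAt.deriv ?_
    have hcomp := HasDerivAt.scomp_of_eq (S s) hwd hinv hinvs.symm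
    refine hcomp.congr_of_eventuallyEq ?_
    have hmem : ∀ᶠ y in 𝓝 (S s), hstrict.localInverse S _ s hne y ∈ Icc 0 σ := by
      refine hinv.continuousAt.eventually_mem ?_
      rwa [hinvs]
    filter_upwards [hstrict.eventually_right_inverse hne, hmem] with y hy hy2
    have h3 := hzw _ hy2
    rw [hSint _ hy2, hy] at h3
    exact h3
  have hzs : z (S s) = w s ^ 2 := by rw [← hSint s hs, hzw s hs]
  have hV : B.VI h (z (S s)) = 1 / 2 * (‖u s‖ ^ 2 / ‖w s‖ ^ 2) := by
    rw [VI, hzs, norm_pow, hE s hs, hΩ2]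
    field_simp
    ring
  rw [hV, hzd, ← div_pow, Real.sqrt_mul (by norm_num), Real.sqrt_sq (by positivity),
    Real.sqrt_div (by norm_num), Real.sqrt_one, norm_smul, norm_mul, norm_mul, abs_of_nonneg (by positivity),
    norm_inv, Real.norm_of_nonneg (by positivity : 0 ≤ 2 * ‖w s‖ ^ 2), smul_eq_mul,
    Complex.norm_ofNat]
  have h2 : √2 ^ 2 = (2 : ℝ) := Real.sq_sqrt (by norm_num)
  field_simp
  linear_combination (-‖u s‖ ^ 2) * h2

lemma innerArc_length {h ξ₁ ξ₂ T : ℝ} {z : ℝ → ℂ} (hh : 0 < B.ℰ + h)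
    (hz : B.IsInnerArc h ξ₁ ξ₂ T z) (hna : ¬ B.Antipodal ξ₁ ξ₂) :
    jacobiLength (B.VI h) T z =
      innerLength (B.lcFreq h) B.μ (‖B.γ ξ₁‖ + ‖B.γ ξ₂‖) (B.lcInner ξ₁ ξ₂) := by
  rcases hz with ⟨-, h1, h2⟩ | ⟨rfl, h1⟩
  · exact B.classicalInnerArc_length hh h1 h2 hna
  · exact B.regularizedInnerArc_length hh h1

lemma lengthOfArc_eq {V : ℂ → ℝ} {P : ℝ → (ℝ → ℂ) → Prop} {l : ℝ} (hP : ExistsUniqueArc P)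
    (hl : ∀ T z, P T z → jacobiLength V T z = l) : lengthOfArc V P = l := by
  have h : ∃ p : ℝ × (ℝ → ℂ), P p.1 p.2 := by
    obtain ⟨T, z, h, -⟩ := hP
    exact ⟨(T, z), h⟩
  rw [lengthOfArc, dif_pos h]
  exact hl _ _ h.choose_spec

lemma SI_eq {h ξ₁ ξ₂ : ℝ} (hh : 0 < B.ℰ + h) (harc : ExistsUniqueArc (B.IsInnerArc h ξ₁ ξ₂))
    (hna : ¬ B.Antipodal ξ₁ ξ₂) :
    B.SI h ξ₁ ξ₂ = innerLength (B.lcFreq h) B.μ (‖B.γ ξ₁‖ + ‖B.γ ξ₂‖) (B.lcInner ξ₁ ξ₂) :=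
  lengthOfArc_eq harc fun _ _ hz => B.innerArc_length hh hz hna

end RefractionBilliard

/-! ### The derivative of the inner length at high energy -/

lemma one_lt_innerCosh {k A B : ℝ} (hk : 0 < k) (hA : 0 ≤ A) (hB : B < 0) :
    1 < innerCosh k A B := by
  rw [innerCosh, one_lt_div hk]
  have h : k ≤ √(B ^ 2 + k * (A + k)) :=
    Real.le_sqrt_of_sq_le (by nlinarith [mul_nonneg hk.le hA, sq_nonneg B])
  linarith

lemma innerCosh_quadratic {k A B : ℝ} (hk : 0 < k) (hA : 0 ≤ A) :
    k * innerCosh k A B ^ 2 + 2 * B * innerCosh k A B = A + k := by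
  have h : √(B ^ 2 + k * (A + k)) ^ 2 = B ^ 2 + k * (A + k) := Real.sq_sqrt (by positivity)
  rw [innerCosh]
  field_simp
  linear_combination h

/-- The length is stationary in the duration, so the derivative `C'` of `innerCosh` cancels and only
its existence matters. -/
lemma innerLength_hasDerivAt {Ω μ x A' B' : ℝ} {A B : ℝ → ℝ} (hΩ : 0 < Ω) (hμ : 0 < μ)
    (hA : HasDerivAt A A' x) (hB : HasDerivAt B B' x) (hA0 : 0 ≤ A x) (hB0 : B x < 0) :
    HasDerivAt (fun t => innerLength Ω μ (A t) (B t))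
      (√2 * Ω * (innerCosh (2 * μ / Ω ^ 2) (A x) (B x) /
        √(innerCosh (2 * μ / Ω ^ 2) (A x) (B x) ^ 2 - 1) * A' / 2 -
        B' / √(innerCosh (2 * μ / Ω ^ 2) (A x) (B x) ^ 2 - 1))) x := by
  have hk : 0 < 2 * μ / Ω ^ 2 := by positivity
  have hC : ∃ C', HasDerivAt (fun t => innerCosh (2 * μ / Ω ^ 2) (A t) (B t)) C' x := by
    have h1 := ((hB.pow 2).add ((hA.add_const (2 * μ / Ω ^ 2)).const_mul (2 * μ / Ω ^ 2))).sqrt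
      (by
        have : 0 < B x ^ 2 := by nlinarith
        simp only [Pi.add_apply, Pi.pow_apply]
        positivity)
    exact ⟨_, (hB.neg.add h1).div_const (2 * μ / Ω ^ 2)⟩
  obtain ⟨C', hC⟩ := hC
  have hC1 := one_lt_innerCosh hk hA0 hB0
  have hquad := innerCosh_quadratic (B := B x) hk hA0
  have hpos : 0 < innerCosh (2 * μ / Ω ^ 2) (A x) (B x) ^ 2 - 1 := by nlinarith
  have hS : HasDerivAt (fun t => √(innerCosh (2 * μ / Ω ^ 2) (A t) (B t) ^ 2 - 1)) _ x :=
    ((hC.pow 2).sub_const 1).sqrt hpos.ne'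
  have har : HasDerivAt (fun t => Real.arcosh (innerCosh (2 * μ / Ω ^ 2) (A t) (B t)))
      ((√(innerCosh (2 * μ / Ω ^ 2) (A x) (B x) ^ 2 - 1))⁻¹ * C') x :=
    HasDerivAt.comp (h₂ := Real.arcosh) x (Real.hasDerivAt_arcosh hC1) hC
  have hSpos : 0 < √(innerCosh (2 * μ / Ω ^ 2) (A x) (B x) ^ 2 - 1) := Real.sqrt_pos.mpr hpos
  have hSsq := Real.sq_sqrt hpos.le
  refine ((((((hC.mul hA).sub (hB.const_mul 2)).div hS hSpos.ne').const_mul (Ω / 2)).add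
    (har.const_mul (μ / Ω))).const_mul √2).congr_deriv ?_
  simp only [Pi.mul_apply, Pi.sub_apply, Pi.pow_apply]
  generalize √(innerCosh (2 * μ / Ω ^ 2) (A x) (B x) ^ 2 - 1) = S at *
  generalize innerCosh (2 * μ / Ω ^ 2) (A x) (B x) = C at *
  -- Stationarity in `C`, which is the quadratic equation rewritten; substituting it for `μ` cancels
  -- the terms in `C'`.
  have hq : Ω ^ 2 * (A x - 2 * B x * C) = 2 * μ * S ^ 2 := by
    field_simp at hquad
    rw [hSsq]
    linear_combination (-1 : ℝ) * hquad
  have hμ' : μ = Ω ^ 2 * (A x - 2 * B x * C) / (2 * S ^ 2) := by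
    field_simp
    linear_combination (-1 : ℝ) * hq
  rw [hμ']
  field_simp
  push_cast
  linear_combination (2 * C' * A x) * hSsq

/-- For small `k`, `innerCosh` is at least of order `1 / k`. The term in `A'` then contributes at
least `|A'| / 2` and the term in `B'` removes at most `|A'| / 4`. -/
lemma innerLength_deriv_bound {k Ω A B A' B' b M e : ℝ} (hk : 0 < k) (hΩ : 0 < Ω) (hA : 0 ≤ A)
    (hb : 0 < b) (hB : B ≤ -b) (hM : |B'| ≤ M) (hkb : k ≤ b) (hkM : M * k / b ≤ |A'| / 4)
    (he : e < √2 * Ω * (|A'| / 4))   :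
    let D := √2 * Ω * (innerCosh k A B / √(innerCosh k A B ^ 2 - 1) * A' / 2 -
        B' / √(innerCosh k A B ^ 2 - 1))
    (0 < A' → e < D) ∧ (A' < 0 → D < -e) := by
  have hC1 := one_lt_innerCosh hk hA (B := B) (by linarith)
  have hquad := innerCosh_quadratic (B := B) hk hA
  generalize innerCosh k A B = C at *
  -- From `C * (k * C + 2 * B) = A + k > 0`.
  have hC2 : 2 * b ≤ k * C := by
    by_contra hn
    nlinarith
  have hS : C - 1 ≤ √(C ^ 2 - 1) := Real.le_sqrt_of_sq_le (by nlinarith)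
  have hSC : √(C ^ 2 - 1) ≤ C := Real.sqrt_le_iff.mpr ⟨by linarith, by linarith⟩
  generalize √(C ^ 2 - 1) = S at *
  have hkS : b ≤ k * S := by nlinarith
  have hSpos : 0 < S := by linarith
  have h1 : |B' / S| ≤ M * k / b := by
    rw [abs_div, abs_of_pos hSpos, div_le_div_iff₀ hSpos hb]
    nlinarith [abs_nonneg B', mul_le_mul hM hkS hb.le ((abs_nonneg _).trans hM)]
  have h2 : 1 ≤ C / S := (one_le_div hSpos).mpr hSC
  have h3 := abs_le.mp h1
  have h4 : 0 < √2 * Ω := by positivity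
  refine ⟨fun hA' => ?_, fun hA' => ?_⟩
  · rw [abs_of_pos hA'] at *
    refine he.trans_le (mul_le_mul_of_nonneg_left ?_ h4.le)
    nlinarith
  · rw [abs_of_neg hA'] at *
    have h5 : C / S * A' / 2 - B' / S ≤ -(-A' / 4) := by nlinarith
    nlinarith [mul_le_mul_of_nonneg_left h5 h4.le]

namespace RefractionBilliard

variable (B : RefractionBilliard)

lemma Ioo_subset_Ioo_of_subset_Icc {a b c d : ℝ} (h : Ioo a b ⊆ Icc c d) : Ioo a b ⊆ Ioo c d := by
  rw [← interior_Icc (a := c)]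
  exact isOpen_Ioo.subset_interior_iff.mpr h

lemma hasStrictDerivAt_γ {ξ : ℝ} (hξ : ξ ∈ Ioo 0 B.L) : HasStrictDerivAt B.γ (deriv B.γ ξ) ξ :=
  (B.contDiffOn_γ.contDiffAt (Icc_mem_nhds hξ.1 hξ.2)).hasStrictDerivAt (by norm_num)

lemma hasDerivAt_γ {ξ : ℝ} (hξ : ξ ∈ Ioo 0 B.L) : HasDerivAt B.γ (deriv B.γ ξ) ξ :=
  (B.hasStrictDerivAt_γ hξ).hasDerivAt

lemma norm_deriv_γ_eq_one {ξ : ℝ} (hξ : ξ ∈ Ioo 0 B.L) : ‖deriv B.γ ξ‖ = 1 := by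
  rw [← B.norm_deriv_γ ξ (Ioo_subset_Icc_self hξ),
    derivWithin_of_mem_nhds (Icc_mem_nhds hξ.1 hξ.2)]

lemma γ_notMem_D {ξ : ℝ} (hξ : ξ ∈ Icc 0 B.L) : B.γ ξ ∉ B.D := by
  have h : B.γ ξ ∈ frontier B.D := B.frontier_D ▸ mem_image_of_mem _ hξ
  rw [B.isOpen_D.frontier_eq] at h
  exact h.2

lemma γ_ne_zero {ξ : ℝ} (hξ : ξ ∈ Icc 0 B.L) : B.γ ξ ≠ 0 := fun h =>
  B.γ_notMem_D hξ (h ▸ B.zero_mem_D)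

lemma norm_γ_le {ξ : ℝ} (hξ : ξ ∈ Icc 0 B.L) : ‖B.γ ξ‖ ≤ √(2 * B.ℰ) / B.ω := by
  have h : B.γ ξ ∈ frontier B.D := B.frontier_D ▸ mem_image_of_mem _ hξ
  have h1 : B.γ ξ ∈ Metric.closedBall (0 : ℂ) (√(2 * B.ℰ) / B.ω) :=
    closure_minimal (B.D_subset_hill.trans Metric.ball_subset_closedBall) Metric.isClosed_closedBall
      (frontier_subset_closure h)
  simpa using h1

lemma hasDerivAt_norm_γ {ξ : ℝ} (hξ : ξ ∈ Ioo 0 B.L) :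
    HasDerivAt (fun x => ‖B.γ x‖) (inner ℝ (B.γ ξ) (deriv B.γ ξ) / ‖B.γ ξ‖) ξ := by
  have hne := B.γ_ne_zero (Ioo_subset_Icc_self hξ)
  have h := (B.hasDerivAt_γ hξ).norm_sq.sqrt (by positivity)
  simp only [Real.sqrt_sq (norm_nonneg _)] at h
  exact h.congr_deriv (by field_simp)

/-- For large energies the partial derivatives of the inner length exist and dominate. -/
lemma eventually_daSI_sign {a b c d α β ξ h₀ e : ℝ} (hab : Ioo a b ⊆ Icc 0 B.L)
    (hcd : Ioo c d ⊆ Icc 0 B.L) (hna : B.NotAntipodal a b c d) (hξ : ξ ∈ Ioo a b)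
    (hαβ : Icc α β ⊆ Ioo c d)
    (harcs : ∀ ξ₁ ∈ Ioo a b, ∀ ξ₂ ∈ Ioo c d, ∀ h > h₀, ExistsUniqueArc (B.IsInnerArc h ξ₁ ξ₂))
    (hf : inner ℝ (B.γ ξ) (deriv B.γ ξ) ≠ 0) :
    ∀ᶠ h in atTop, ∀ ξI ∈ Icc α β, DifferentiableAt ℝ (fun x => B.SI h x ξI) ξ ∧
      (0 < inner ℝ (B.γ ξ) (deriv B.γ ξ) → e < B.daSI h ξ ξI) ∧
      (inner ℝ (B.γ ξ) (deriv B.γ ξ) < 0 → B.daSI h ξ ξI < -e) := by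
  have hμ := B.μ_pos
  have hξL := Ioo_subset_Ioo_of_subset_Icc hab hξ
  have hne := B.γ_ne_zero (hab hξ)
  have hn : 0 < ‖B.γ ξ‖ := norm_pos_iff.mpr hne
  set f := inner ℝ (B.γ ξ) (deriv B.γ ξ) with hfdef
  set n' := f / ‖B.γ ξ‖ with hn'
  have hn'1 : |n'| ≤ 1 := by
    rw [hn', abs_div, abs_of_pos hn, div_le_one hn]
    have := abs_real_inner_le_norm (B.γ ξ) (deriv B.γ ξ)
    rwa [B.norm_deriv_γ_eq_one hξL, mul_one] at this
  have hn'0 : n' ≠ 0 := div_ne_zero hf hn.ne'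
  have hpos : ∀ ξI ∈ Ioo c d, 0 < (‖B.γ ξ‖ * ‖B.γ ξI‖ + inner ℝ (B.γ ξ) (B.γ ξI)) / 2 :=
    fun ξI hI => half_pos (norm_mul_norm_add_inner_pos hne (B.γ_ne_zero (hcd hI)) (hna ξ hξ ξI hI))
  have hcont : ContinuousOn B.γ (Icc α β) := B.contDiffOn_γ.continuousOn.mono (hαβ.trans hcd)
  -- Compactness of `[α, β]` makes the bound uniform, so that one threshold on `h` serves every
  -- `ξI`.
  obtain ⟨δ, hδ, hlb⟩ : ∃ δ > 0, ∀ ξI ∈ Icc α β, B.lcInner ξ ξI ≤ -δ := by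
    obtain ⟨δ, hδ, h⟩ := isCompact_Icc.exists_forall_le' (a := (0 : ℝ))
      (f := fun ξI => √((‖B.γ ξ‖ * ‖B.γ ξI‖ + inner ℝ (B.γ ξ) (B.γ ξI)) / 2)) (s := Icc α β)
      (by fun_prop) (fun ξI hI => Real.sqrt_pos.mpr (hpos ξI (hαβ hI)))
    exact ⟨δ, hδ, fun ξI hI => neg_le_neg (h ξI hI)⟩
  set R := √(2 * B.ℰ) / B.ω
  -- Bound for the derivative of `lcInner`: its numerator is at most the Hill radius `R`, its
  -- denominator at least `2 * δ`.
  set M := R / (2 * δ) with hM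
  have hR : 0 ≤ R := div_nonneg (Real.sqrt_nonneg _) B.ω_pos.le
  have hM0 : 0 ≤ M := by positivity
  have hΩtop : Tendsto B.lcFreq atTop atTop :=
    Real.tendsto_sqrt_atTop.comp
      ((tendsto_atTop_add_const_left atTop B.ℰ tendsto_id).const_mul_atTop two_pos)
  have hk : Tendsto (fun h => 2 * B.μ / B.lcFreq h ^ 2) atTop (𝓝 0) :=
    ((tendsto_pow_atTop two_ne_zero).comp hΩtop).const_div_atTop _
  have hk2 : Tendsto (fun h => M * (2 * B.μ / B.lcFreq h ^ 2) / δ) atTop (𝓝 0) := by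
    simpa using (hk.const_mul M).div_const δ
  have hΩ2 : Tendsto (fun h => √2 * B.lcFreq h * (|n'| / 4)) atTop atTop :=
    (hΩtop.const_mul_atTop (by positivity)).atTop_mul_const (by positivity)
  filter_upwards [hk.eventually_le_const hδ, hk2.eventually_le_const (by positivity : 0 < |n'| / 4),
    hΩ2.eventually_gt_atTop e, hΩtop.eventually_gt_atTop 0, eventually_gt_atTop h₀,
    eventually_gt_atTop 0] with h h1 h2 h3 h4 h5 h6 ξI hI
  have hh : 0 < B.ℰ + h := by linarith [B.ℰ_pos]
  have hA : HasDerivAt (fun x => ‖B.γ x‖ + ‖B.γ ξI‖) n' ξ :=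
    (B.hasDerivAt_norm_γ hξL).add_const _
  have hposI := hpos ξI (hαβ hI)
  have hsqrt := hlb ξI hI
  have hB : HasDerivAt (fun x => B.lcInner x ξI)
      (-((n' * ‖B.γ ξI‖ + inner ℝ (deriv B.γ ξ) (B.γ ξI)) / 2 /
        (2 * √((‖B.γ ξ‖ * ‖B.γ ξI‖ + inner ℝ (B.γ ξ) (B.γ ξI)) / 2)))) ξ := by
    have := ((((B.hasDerivAt_norm_γ hξL).mul_const ‖B.γ ξI‖).add
      ((B.hasDerivAt_γ hξL).inner ℝ (hasDerivAt_const ξ (B.γ ξI)))).div_const 2).sqrt hposI.ne'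
    refine this.neg.congr_deriv ?_
    simp [hn', hfdef]
  have hBM : |-((n' * ‖B.γ ξI‖ + inner ℝ (deriv B.γ ξ) (B.γ ξI)) / 2 /
        (2 * √((‖B.γ ξ‖ * ‖B.γ ξI‖ + inner ℝ (B.γ ξ) (B.γ ξI)) / 2)))| ≤ M := by
    rw [lcInner, neg_le_neg_iff] at hsqrt
    rw [abs_neg, abs_div, hM, abs_of_nonneg (by positivity : 0 ≤ 2 * √((‖B.γ ξ‖ * ‖B.γ ξI‖ + inner ℝ (B.γ ξ) (B.γ ξI)) / 2))]
    refine div_le_div₀ hR ?_ (by positivity) (by linarith)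
    have h7 := abs_real_inner_le_norm (deriv B.γ ξ) (B.γ ξI)
    rw [B.norm_deriv_γ_eq_one hξL, one_mul] at h7
    have h8 := B.norm_γ_le (hcd (hαβ hI))
    have h9 : |n' * ‖B.γ ξI‖| ≤ ‖B.γ ξI‖ := by
      rw [abs_mul, abs_norm]
      exact mul_le_of_le_one_left (norm_nonneg _) hn'1
    rw [abs_div, abs_of_pos (two_pos : (0 : ℝ) < 2), div_le_iff₀ two_pos]
    have := abs_add_le (n' * ‖B.γ ξI‖) (inner ℝ (deriv B.γ ξ) (B.γ ξI))
    linarith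
  have hderiv := innerLength_hasDerivAt h4 hμ hA hB (by positivity) (by linarith)
  have hSI : HasDerivAt (fun x => B.SI h x ξI) _ ξ := hderiv.congr_of_eventuallyEq (by
    filter_upwards [Ioo_mem_nhds hξ.1 hξ.2] with x hx
    exact B.SI_eq hh (harcs x hx ξI (hαβ hI) h h5) (hna x hx ξI (hαβ hI)))
  have hbound := innerLength_deriv_bound (A := ‖B.γ ξ‖ + ‖B.γ ξI‖) (by positivity) h4
    (by positivity) hδ hsqrt hBM h1 h2 h3
  refine ⟨hSI.differentiableAt, fun hf => ?_, fun hf => ?_⟩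
  · rw [daSI, hSI.deriv]
    exact hbound.1 (div_pos hf hn)
  · rw [daSI, hSI.deriv]
    exact hbound.2 (div_neg_of_neg_of_pos hf hn)

end RefractionBilliard

/-! ### Outer arcs: initial velocity, duration and length -/

/-- The harmonic motion with initial position `p` and initial velocity `v`. -/
noncomputable def harmonicArc (ω : ℝ) (p v : ℂ) (s : ℝ) : ℂ :=
  Real.cos (ω * s) • p + (Real.sin (ω * s) / ω) • v

/-- The velocity of `harmonicArc`. -/
noncomputable def harmonicVel (ω : ℝ) (p v : ℂ) (s : ℝ) : ℂ :=
  (-(ω * Real.sin (ω * s))) • p + Real.cos (ω * s) • v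

lemma hasDerivAt_harmonicArc {ω : ℝ} (hω : ω ≠ 0) (p v : ℂ) (s : ℝ) :
    HasDerivAt (harmonicArc ω p v) (harmonicVel ω p v s) s := by
  have hx := (hasDerivAt_id s).const_mul ω
  refine ((hx.cos.smul_const p).add ((hx.sin.div_const ω).smul_const v)).congr_deriv ?_
  simp only [harmonicVel, id]
  match_scalars <;> field_simp

lemma hasDerivAt_harmonicVel {ω : ℝ} (hω : ω ≠ 0) (p v : ℂ) (s : ℝ) :
    HasDerivAt (harmonicVel ω p v) (-(ω ^ 2 • harmonicArc ω p v s)) s := by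
  have hx := (hasDerivAt_id s).const_mul ω
  refine (((hx.sin.const_mul ω).neg.smul_const p).add (hx.cos.smul_const v)).congr_deriv ?_
  simp only [harmonicArc, id]
  match_scalars <;> (field_simp; try ring)

lemma harmonic_energy {ω : ℝ} (hω : ω ≠ 0) (p v : ℂ) (s : ℝ) :
    ‖harmonicVel ω p v s‖ ^ 2 + ω ^ 2 * ‖harmonicArc ω p v s‖ ^ 2 =
      ‖v‖ ^ 2 + ω ^ 2 * ‖p‖ ^ 2 := by
  have h := Real.sin_sq_add_cos_sq (ω * s)
  simp only [harmonicVel, harmonicArc, norm_add_sq_real, norm_smul, real_inner_smul_left,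
    real_inner_smul_right, mul_pow, Real.norm_eq_abs, sq_abs]
  field_simp
  linear_combination (ω ^ 2 * ‖p‖ ^ 2 + ‖v‖ ^ 2) * h

lemma harmonicArc_zero (ω : ℝ) (p v : ℂ) : harmonicArc ω p v 0 = p := by simp [harmonicArc]

lemma harmonicVel_zero (ω : ℝ) (p v : ℂ) : harmonicVel ω p v 0 = v := by simp [harmonicVel]

namespace RefractionBilliard

variable (B : RefractionBilliard)

/-- `v` is the initial velocity of an outer arc of duration `T`. -/
structure IsOuterVelocity (ξ₁ ξ₂ T : ℝ) (v : ℂ) : Prop where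
  pos : 0 < T
  energy : ‖v‖ ^ 2 + B.ω ^ 2 * ‖B.γ ξ₁‖ ^ 2 = 2 * B.ℰ
  notMem : ∀ s ∈ Ioo 0 T, harmonicArc B.ω (B.γ ξ₁) v s ∉ B.D
  endpoint : harmonicArc B.ω (B.γ ξ₁) v T = B.γ ξ₂

variable {B}

lemma IsOuterVelocity.isOuterArc {ξ₁ ξ₂ T : ℝ} {v : ℂ} (h : B.IsOuterVelocity ξ₁ ξ₂ T v) :
    B.IsOuterArc ξ₁ ξ₂ T (harmonicArc B.ω (B.γ ξ₁) v) := by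
  refine ⟨h.pos, ⟨harmonicVel B.ω (B.γ ξ₁) v, fun s _ =>
    ⟨(hasDerivAt_harmonicArc B.ω_pos.ne' _ _ s).hasDerivWithinAt,
      (hasDerivAt_harmonicVel B.ω_pos.ne' _ _ s).hasDerivWithinAt, ?_⟩⟩, h.notMem,
    harmonicArc_zero _ _ _, h.endpoint⟩
  linear_combination 1 / 2 * harmonic_energy B.ω_pos.ne' (B.γ ξ₁) v s + 1 / 2 * h.energy

lemma IsOuterArc.exists_velocity {ξ₁ ξ₂ T : ℝ} {z : ℝ → ℂ} (h : B.IsOuterArc ξ₁ ξ₂ T z) :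
    ∃ v, B.IsOuterVelocity ξ₁ ξ₂ T v ∧ EqOn z (harmonicArc B.ω (B.γ ξ₁) v) (Icc 0 T) := by
  obtain ⟨hT, ⟨v, hv⟩, hD, h0, h1⟩ := h
  have hflow := harmonic_flow B.ω_pos.ne' (fun s hs => (hv s hs).1) (fun s hs => (hv s hs).2.1)
  have heq : EqOn z (harmonicArc B.ω (B.γ ξ₁) (v 0)) (Icc 0 T) := fun s hs => by
    rw [(hflow s hs).1, h0, harmonicArc]
  refine ⟨v 0, ⟨hT, ?_, fun s hs => ?_, ?_⟩, heq⟩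
  · have := (hv 0 (left_mem_Icc.mpr hT.le)).2.2
    rw [h0] at this
    linear_combination 2 * this
  · rw [← heq (Ioo_subset_Icc_self hs)]
    exact hD s hs
  · rw [← heq (right_mem_Icc.mpr hT.le), h1]

/-- Existence and uniqueness of outer arcs in terms of their initial velocities. -/
lemma exists_unique_outerVelocity {ξ₁ ξ₂ : ℝ} (h : ExistsUniqueArc (B.IsOuterArc ξ₁ ξ₂)) :
    ∃ T v, B.IsOuterVelocity ξ₁ ξ₂ T v ∧
      ∀ T' v', B.IsOuterVelocity ξ₁ ξ₂ T' v' → T' = T ∧ v' = v := by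
  obtain ⟨T, z, hz, huniq⟩ := h
  obtain ⟨v, hv, hzv⟩ := hz.exists_velocity
  refine ⟨T, v, hv, fun T' v' hv' => ?_⟩
  obtain ⟨rfl, heq⟩ := huniq _ _ hv'.isOuterArc
  refine ⟨rfl, ?_⟩
  have h0 : (0 : ℝ) ∈ Icc 0 T' := left_mem_Icc.mpr hv.pos.le
  have h1 := (hasDerivAt_harmonicArc B.ω_pos.ne' (B.γ ξ₁) v' 0).hasDerivWithinAt (s := Icc 0 T')
  have h2 := (hasDerivAt_harmonicArc B.ω_pos.ne' (B.γ ξ₁) v 0).hasDerivWithinAt (s := Icc 0 T')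
  have h3 := h2.congr (heq.trans hzv) ((heq.trans hzv) h0)
  rw [harmonicVel_zero] at h1 h3
  exact (uniqueDiffOn_Icc hv.pos 0 h0).eq_deriv _ h1 h3

/-- The action of an outer arc of duration `T`, in terms of `P = ‖p‖² + ‖q‖²` and `Q = ⟪p, q⟫`. -/
noncomputable def _root_.outerLength (ω ℰ T P Q : ℝ) : ℝ :=
  (ω / 2 * ((Real.cos (ω * T) * P - 2 * Q) / Real.sin (ω * T)) + ℰ * T) / √2

lemma outerArc_length {ξ₁ ξ₂ T : ℝ} {z : ℝ → ℂ} {v : ℂ} (h : B.IsOuterVelocity ξ₁ ξ₂ T v)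
    (hz : EqOn z (harmonicArc B.ω (B.γ ξ₁) v) (Icc 0 T)) (hs : Real.sin (B.ω * T) ≠ 0) :
    jacobiLength B.VE T z =
      outerLength B.ω B.ℰ T (‖B.γ ξ₁‖ ^ 2 + ‖B.γ ξ₂‖ ^ 2) (inner ℝ (B.γ ξ₁) (B.γ ξ₂)) := by
  have hω := B.ω_pos
  have h1 : ∫ s in (0 : ℝ)..T, ‖harmonicVel B.ω (B.γ ξ₁) v s‖ ^ 2 =
      (inner ℝ (harmonicArc B.ω (B.γ ξ₁) v T) (harmonicVel B.ω (B.γ ξ₁) v T) -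
        inner ℝ (B.γ ξ₁) v) / 2 + B.ℰ * T := by
    have hF : ∀ s, HasDerivAt (fun s => inner ℝ (harmonicArc B.ω (B.γ ξ₁) v s)
        (harmonicVel B.ω (B.γ ξ₁) v s) / 2 + B.ℰ * s) (‖harmonicVel B.ω (B.γ ξ₁) v s‖ ^ 2) s := by
      intro s
      refine ((((hasDerivAt_harmonicArc hω.ne' (B.γ ξ₁) v s).inner ℝ
        (hasDerivAt_harmonicVel hω.ne' (B.γ ξ₁) v s)).div_const 2).add
        ((hasDerivAt_id s).const_mul B.ℰ)).congr_deriv ?_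
      rw [inner_neg_right, real_inner_smul_right, real_inner_self_eq_norm_sq,
        real_inner_self_eq_norm_sq]
      linear_combination (-1 / 2) * harmonic_energy hω.ne' (B.γ ξ₁) v s - 1 / 2 * h.energy
    rw [intervalIntegral.integral_eq_sub_of_hasDerivAt (fun s _ => hF s)]
    · simp only [harmonicArc_zero, harmonicVel_zero]
      ring
    · refine Continuous.intervalIntegrable ?_ _ _
      unfold harmonicVel
      fun_prop
  have h2 : jacobiLength B.VE T z =
      (∫ s in (0 : ℝ)..T, ‖harmonicVel B.ω (B.γ ξ₁) v s‖ ^ 2) / √2 := by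
    rw [jacobiLength, ← intervalIntegral.integral_div]
    refine intervalIntegral.integral_congr_ae ?_
    have hae : ∀ᵐ s : ℝ, s ≠ T := by simp [ae_iff, measure_singleton]
    filter_upwards [hae] with s hsT hs
    rw [uIoc_of_le h.pos.le] at hs
    have hs' : s ∈ Ioo 0 T := ⟨hs.1, lt_of_le_of_ne hs.2 hsT⟩
    have hev : z =ᶠ[𝓝 s] harmonicArc B.ω (B.γ ξ₁) v := by
      filter_upwards [Icc_mem_nhds hs'.1 hs'.2] with r hr using hz hr
    have hV : B.VE (z s) = 1 / 2 * ‖harmonicVel B.ω (B.γ ξ₁) v s‖ ^ 2 := by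
      rw [VE, hev.eq_of_nhds]
      linear_combination (-1 / 2) * harmonic_energy hω.ne' (B.γ ξ₁) v s - 1 / 2 * h.energy
    rw [hev.deriv_eq, (hasDerivAt_harmonicArc hω.ne' _ _ s).deriv, hV,
      Real.sqrt_mul (by norm_num), Real.sqrt_sq (norm_nonneg _), Real.sqrt_div (by norm_num),
      Real.sqrt_one]
    ring
  have hcs := Real.sin_sq_add_cos_sq (B.ω * T)
  have hen := h.energy
  rw [h2, h1, outerLength, ← h.endpoint]
  simp only [harmonicVel, harmonicArc, norm_add_sq_real, norm_smul, real_inner_smul_left,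
    real_inner_smul_right, mul_pow, Real.norm_eq_abs, sq_abs, inner_add_left, inner_add_right,
    real_inner_self_eq_norm_sq, real_inner_comm (B.γ ξ₁) v]
  congr 2
  field_simp
  generalize Real.cos (B.ω * T) = c at *
  generalize Real.sin (B.ω * T) = s at *
  linear_combination (-(B.ω ^ 2 * c * ‖B.γ ξ₁‖ ^ 2) - B.ω * s * inner ℝ (B.γ ξ₁) v) * hcs

/-- Eliminating `v` between the energy and the endpoint equation leaves a quadratic equation for
`cos (ω T)`. -/
lemma IsOuterVelocity.quadratic {ξ₁ ξ₂ T : ℝ} {v : ℂ} (h : B.IsOuterVelocity ξ₁ ξ₂ T v) :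
    B.ω ^ 2 * (‖B.γ ξ₁‖ ^ 2 + ‖B.γ ξ₂‖ ^ 2 -
      2 * Real.cos (B.ω * T) * inner ℝ (B.γ ξ₁) (B.γ ξ₂)) =
      2 * B.ℰ * (1 - Real.cos (B.ω * T) ^ 2) := by
  have hω := B.ω_pos
  have hcs := Real.sin_sq_add_cos_sq (B.ω * T)
  have hen := h.energy
  rw [← h.endpoint]
  simp only [harmonicArc, norm_add_sq_real, norm_smul, real_inner_smul_left,
    real_inner_smul_right, mul_pow, Real.norm_eq_abs, sq_abs, inner_add_right,
    real_inner_self_eq_norm_sq]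
  field_simp
  generalize Real.cos (B.ω * T) = c at *
  generalize Real.sin (B.ω * T) = s at *
  linear_combination ‖v‖ ^ 2 * hcs + (1 - c ^ 2) * hen

/-- Otherwise the final point is minus the initial one, which is antipodal, or equal to it. In the
latter case the reversed motion is an arc of the same duration, so uniqueness gives `v = 0`, and
motion from rest falls through the origin. -/
lemma IsOuterVelocity.sin_ne_zero {ξ₁ ξ₂ T : ℝ} {v : ℂ} (h : B.IsOuterVelocity ξ₁ ξ₂ T v)
    (huniq : ∀ T' v', B.IsOuterVelocity ξ₁ ξ₂ T' v' → T' = T ∧ v' = v)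
    (hna : ¬ B.Antipodal ξ₁ ξ₂) : Real.sin (B.ω * T) ≠ 0 := by
  have hω := B.ω_pos
  intro hs
  have hcs := Real.sin_sq_add_cos_sq (B.ω * T)
  rw [hs] at hcs
  have hend := h.endpoint
  rw [harmonicArc, hs, zero_div, zero_smul, add_zero] at hend
  have hc : Real.cos (B.ω * T) = 1 := by
    rcases eq_or_eq_neg_of_sq_eq_sq (Real.cos (B.ω * T)) 1 (by linarith) with hc | hc
    · exact hc
    · exfalso
      apply hna
      rw [Antipodal, ← hend, hc]
      refine ⟨1 / 2, 1 / 2, by norm_num, by norm_num, by norm_num, ?_⟩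
      module
  have hrev : ∀ s, harmonicArc B.ω (B.γ ξ₁) (-v) s = harmonicArc B.ω (B.γ ξ₁) v (T - s) := by
    intro s
    simp only [harmonicArc, mul_sub, Real.cos_sub, Real.sin_sub, hs, hc]
    module
  have hneg : B.IsOuterVelocity ξ₁ ξ₂ T (-v) := by
    refine ⟨h.pos, by rw [norm_neg]; exact h.energy, fun s hs => ?_, ?_⟩
    · rw [hrev]
      exact h.notMem _ ⟨by linarith [hs.2], by linarith [hs.1]⟩
    · rw [hrev, sub_self, harmonicArc_zero, ← hend, hc, one_smul]
  have hv : v = 0 := by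
    have := (huniq _ _ hneg).2
    exact self_eq_neg.mp this.symm
  obtain ⟨n, hn⟩ := Real.sin_eq_zero_iff.mp hs
  have hn1 : (1 : ℤ) ≤ n := by
    by_contra hn1
    have h1 : n ≤ 0 := by omega
    have h2 : (n : ℝ) ≤ 0 := by exact_mod_cast h1
    nlinarith [mul_pos hω h.pos, Real.pi_pos]
  have hn2 : (1 : ℝ) ≤ n := by exact_mod_cast hn1
  have hT : Real.pi ≤ B.ω * T := by nlinarith [Real.pi_pos]
  -- From rest the origin is reached after a quarter period, before `T` because `ω T ≥ π`.
  have hmem : Real.pi / (2 * B.ω) ∈ Ioo 0 T := by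
    refine ⟨by have := Real.pi_pos; positivity, ?_⟩
    rw [div_lt_iff₀ (by positivity)]
    nlinarith [Real.pi_pos]
  apply h.notMem _ hmem
  rw [hv, harmonicArc, show B.ω * (Real.pi / (2 * B.ω)) = Real.pi / 2 by field_simp,
    Real.cos_pi_div_two, zero_smul, smul_zero, add_zero]
  exact B.zero_mem_D

/-- A longer arc could be shortened by one period, against uniqueness. -/
lemma IsOuterVelocity.time_le {ξ₁ ξ₂ T : ℝ} {v : ℂ} (h : B.IsOuterVelocity ξ₁ ξ₂ T v)
    (huniq : ∀ T' v', B.IsOuterVelocity ξ₁ ξ₂ T' v' → T' = T ∧ v' = v) :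
    T ≤ 2 * Real.pi / B.ω := by
  have hω := B.ω_pos
  by_contra hT
  have hpi : 0 < 2 * Real.pi / B.ω := by have := Real.pi_pos; positivity
  have hper : harmonicArc B.ω (B.γ ξ₁) v (T - 2 * Real.pi / B.ω) =
      harmonicArc B.ω (B.γ ξ₁) v T := by
    rw [harmonicArc, harmonicArc, mul_sub,
      show B.ω * (2 * Real.pi / B.ω) = 2 * Real.pi by field_simp, Real.cos_sub_two_pi,
      Real.sin_sub_two_pi]
  have := (huniq (T - 2 * Real.pi / B.ω) v ⟨by linarith, h.energy,
    fun s hs => h.notMem s ⟨hs.1, by linarith [hs.2]⟩, hper.trans h.endpoint⟩).1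
  linarith

lemma SE_eq {ξ₁ ξ₂ T : ℝ} {v : ℂ} (harc : ExistsUniqueArc (B.IsOuterArc ξ₁ ξ₂))
    (hna : ¬ B.Antipodal ξ₁ ξ₂) (hv : B.IsOuterVelocity ξ₁ ξ₂ T v) :
    B.SE ξ₁ ξ₂ =
      outerLength B.ω B.ℰ T (‖B.γ ξ₁‖ ^ 2 + ‖B.γ ξ₂‖ ^ 2) (inner ℝ (B.γ ξ₁) (B.γ ξ₂)) := by
  refine lengthOfArc_eq harc fun T' z hz => ?_
  obtain ⟨v', hv', hzv'⟩ := hz.exists_velocity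
  obtain ⟨T₀, v₀, hv₀, huniq⟩ := exists_unique_outerVelocity harc
  obtain ⟨rfl, rfl⟩ := huniq _ _ hv
  obtain ⟨rfl, rfl⟩ := huniq _ _ hv'
  exact outerArc_length hv' hzv' (hv'.sin_ne_zero huniq hna)

end RefractionBilliard

/-! ### Differentiating the outer length when the duration is only continuous -/

/-- Where `f` vanishes, the difference quotient of the product is that of `f` times `g`, so
continuity of `g` is enough. -/
lemma HasDerivAt.mul_continuousAt_of_eq_zero {f g : ℝ → ℝ} {f' x : ℝ} (hf : HasDerivAt f f' x)
    (hf0 : f x = 0) (hg : ContinuousAt g x) :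
    HasDerivAt (fun t => f t * g t) (f' * g x) x := by
  rw [hasDerivAt_iff_tendsto_slope] at hf ⊢
  refine (hf.mul (hg.tendsto.mono_left nhdsWithin_le_nhds)).congr fun t => ?_
  simp only [slope_def_field, hf0]
  ring

/-- Continuity of the remainder is what survives composition with a merely continuous phase. -/
lemma AnalyticAt.exists_taylor_two {f : ℝ → ℝ} {x : ℝ} (hf : AnalyticAt ℝ f x) :
    ∃ r : ℝ → ℝ, ContinuousAt r x ∧
      ∀ t, f t = f x + deriv f x * (t - x) + (t - x) ^ 2 * r t := by
  obtain ⟨p, hp⟩ := hf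
  have h1 := hp.has_fpower_series_dslope_fslope
  have h2 := h1.has_fpower_series_dslope_fslope
  refine ⟨dslope (dslope f x) x, h2.analyticAt.continuousAt, fun t => ?_⟩
  have e1 := sub_smul_dslope f x t
  have e2 := sub_smul_dslope (dslope f x) x t
  rw [dslope_same] at e2
  simp only [smul_eq_mul] at e1 e2
  linear_combination (-1 : ℝ) * e1 - (t - x) * e2

/-- The cosine of the duration varies at most like the square root of the parameter, even where
the endpoint lies on the envelope of the trajectories. -/
lemma hasDerivAt_sq_cos_sub {R x A' B' : ℝ} {A B c : ℝ → ℝ} (hR : 0 < R)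
    (hA : HasDerivAt A A' x) (hB : HasDerivAt B B' x) (hc : ContinuousAt c x)
    (h : ∀ᶠ t in 𝓝 x, A t - 2 * c t * B t = R * (1 - c t ^ 2)) :
    HasDerivAt (fun t => (c t - c x) ^ 2) 0 x := by
  set d : ℝ → ℝ := fun t => c t - c x with hd
  have hdc : ContinuousAt d x := hc.sub continuousAt_const
  have hd0 : d x = 0 := sub_self _
  set e : ℝ → ℝ := fun t => A t - 2 * c x * B t - R * (1 - c x ^ 2) with he
  have hx := h.self_of_nhds
  have he0 : e x = 0 := by
    rw [he]
    linear_combination hx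
  have hed : HasDerivAt e (A' - 2 * c x * B') x := (hA.sub (hB.const_mul (2 * c x))).sub_const _
  have hrel : ∀ᶠ t in 𝓝 x, R * d t ^ 2 + 2 * (R * c x - B t) * d t + e t = 0 := by
    filter_upwards [h] with t ht
    simp only [hd, he]
    linear_combination ht
  -- Double root: the relation reads `R * d ^ 2 = 2 * (B - B x) * d - e`, whose right side is
  -- differentiable; the minimum at `x` makes the derivative vanish.
  by_cases hκ : R * c x - B x = 0
  · have h1 : HasDerivAt (fun t => (B t - B x) * d t) (B' * d x) x :=
      (hB.sub_const (B x)).mul_continuousAt_of_eq_zero (sub_self _) hdc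
    have h2 : HasDerivAt (fun t => R * d t ^ 2) (2 * (B' * d x) - (A' - 2 * c x * B')) x := by
      refine ((h1.const_mul 2).sub hed).congr_of_eventuallyEq ?_
      filter_upwards [hrel] with t ht
      simp only [Pi.sub_apply]
      linear_combination ht - 2 * hκ * d t
    have hmin : IsLocalMin (fun t => R * d t ^ 2) x :=
      Eventually.of_forall fun t => by
        change R * d x ^ 2 ≤ R * d t ^ 2
        rw [hd0]
        have := mul_nonneg hR.le (sq_nonneg (d t))
        simpa using this
    rw [hmin.hasDerivAt_eq_zero h2] at h2
    have h3 := h2.div_const R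
    rw [zero_div] at h3
    refine h3.congr_of_eventuallyEq (Eventually.of_forall fun t => ?_)
    simp only [hd]
    field_simp
  -- Simple root: the relation factors as `d * g = -e` with `g x ≠ 0`, so `d` itself is
  -- differentiable.
  · set g : ℝ → ℝ := fun t => R * d t + 2 * (R * c x - B t) with hg
    have hgc : ContinuousAt g x :=
      (hdc.const_mul R).add ((continuousAt_const.sub hB.continuousAt).const_mul 2)
    have hg0 : g x ≠ 0 := by
      simp only [hg, hd0, mul_zero, zero_add]
      exact mul_ne_zero two_ne_zero hκ
    have h1 : HasDerivAt d (-((A' - 2 * c x * B') * (g x)⁻¹)) x := by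
      refine (hed.mul_continuousAt_of_eq_zero he0 (hgc.inv₀ hg0)).neg.congr_of_eventuallyEq ?_
      filter_upwards [hrel, hgc.eventually_ne hg0] with t ht hgt
      simp only [Pi.inv_apply, Pi.neg_apply]
      field_simp
      simp only [hg]
      linear_combination ht
    refine (h1.pow 2).congr_deriv ?_
    simp [hd0]

/-- Expand `cot` and `csc` to second order in the phase `θ = ω T`. The zeroth-order part gives the
derivative, the first-order coefficient vanishes at `x` by the quadratic equation, and the
second-order part is negligible since `(θ t - θ x) ^ 2 = o(t - x)`. -/
lemma outerLength_hasDerivAt {ω ℰ x A' B' : ℝ} {A B T : ℝ → ℝ} (hω : 0 < ω) (hℰ : 0 < ℰ)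
    (hA : HasDerivAt A A' x) (hB : HasDerivAt B B' x) (hT : ContinuousAt T x)
    (h : ∀ᶠ t in 𝓝 x, ω ^ 2 * (A t - 2 * Real.cos (ω * T t) * B t) =
      2 * ℰ * (1 - Real.cos (ω * T t) ^ 2))
    (hs : Real.sin (ω * T x) ≠ 0) :
    HasDerivAt (fun t => outerLength ω ℰ (T t) (A t) (B t))
      (ω / 2 * ((Real.cos (ω * T x) * A' - 2 * B') / Real.sin (ω * T x)) / √2) x := by
  set θ : ℝ → ℝ := fun t => ω * T t with hθ
  have hθc : ContinuousAt θ x := hT.const_mul ω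
  set R := 2 * ℰ / ω ^ 2 with hRdef
  have hR : 0 < R := by positivity
  have h' : ∀ᶠ t in 𝓝 x, A t - 2 * Real.cos (θ t) * B t = R * (1 - Real.cos (θ t) ^ 2) := by
    filter_upwards [h] with t ht
    rw [hRdef]
    field_simp
    linear_combination ht
  have hx := h'.self_of_nhds
  have hcosθ : ContinuousAt (fun t => Real.cos (θ t)) x :=
    Real.continuous_cos.continuousAt.comp hθc
  have hd2 : HasDerivAt (fun t => (Real.cos (θ t) - Real.cos (θ x)) ^ 2) 0 x :=
    hasDerivAt_sq_cos_sub hR hA hB hcosθ h'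
  -- As `sin (θ x) ≠ 0`, increments of `cos θ` are comparable with those of `θ`.
  have hδ2 : HasDerivAt (fun t => (θ t - θ x) ^ 2) 0 x := by
    have hds : ContinuousAt (fun t => dslope Real.cos (θ x) (θ t)) x :=
      ContinuousAt.comp_of_eq (f := θ) (y := θ x)
        (continuousAt_dslope_same.mpr Real.differentiableAt_cos) hθc rfl
    have hds0 : dslope Real.cos (θ x) (θ x) ≠ 0 := by
      rw [dslope_same, Real.deriv_cos]
      exact neg_ne_zero.mpr hs
    have h1 := hd2.mul_continuousAt_of_eq_zero (by simp) ((hds.inv₀ hds0).pow 2)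
    rw [zero_mul] at h1
    refine h1.congr_of_eventuallyEq ?_
    filter_upwards [hds.eventually_ne hds0] with t ht
    have := sub_smul_dslope Real.cos (θ x) (θ t)
    rw [smul_eq_mul] at this
    rw [← this]
    simp only [Pi.pow_apply, Pi.inv_apply]
    field_simp
  have hcsc : AnalyticAt ℝ (fun y => (Real.sin y)⁻¹) (θ x) := Real.analyticAt_sin.inv hs
  have hcot : AnalyticAt ℝ (fun y => Real.cos y * (Real.sin y)⁻¹) (θ x) :=
    Real.analyticAt_cos.mul hcsc
  have hcsc' : deriv (fun y => (Real.sin y)⁻¹) (θ x) = -Real.cos (θ x) / Real.sin (θ x) ^ 2 :=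
    ((Real.hasDerivAt_sin (θ x)).inv hs).deriv
  have hcs := Real.sin_sq_add_cos_sq (θ x)
  have hcot' : deriv (fun y => Real.cos y * (Real.sin y)⁻¹) (θ x) = -1 / Real.sin (θ x) ^ 2 := by
    refine ((Real.hasDerivAt_cos (θ x)).mul ((Real.hasDerivAt_sin (θ x)).inv hs)).deriv.trans ?_
    have hs' : Real.sin (θ x) ≠ 0 := hs
    simp only [Pi.inv_apply]
    field_simp
    linear_combination (-1 : ℝ) * hcs
  obtain ⟨r₁, hr₁, e₁⟩ := hcot.exists_taylor_two
  obtain ⟨r₂, hr₂, e₂⟩ := hcsc.exists_taylor_two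
  rw [hcot'] at e₁
  rw [hcsc'] at e₂
  have hs' : Real.sin (θ x) ≠ 0 := hs
  have H1 : HasDerivAt (fun t => A t * (Real.cos (θ x) * (Real.sin (θ x))⁻¹) -
      2 * B t * (Real.sin (θ x))⁻¹ + R * θ x)
      (A' * (Real.cos (θ x) * (Real.sin (θ x))⁻¹) - 2 * B' * (Real.sin (θ x))⁻¹) x :=
    ((hA.mul_const _).sub ((hB.const_mul 2).mul_const _)).add_const _
  have H2 : HasDerivAt (fun t => (A t * (-1 / Real.sin (θ x) ^ 2) -
      2 * B t * (-Real.cos (θ x) / Real.sin (θ x) ^ 2) + R) * (θ t - θ x)) 0 x := by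
    have := (((hA.mul_const (-1 / Real.sin (θ x) ^ 2)).sub
      ((hB.const_mul 2).mul_const (-Real.cos (θ x) / Real.sin (θ x) ^ 2))).add_const
        R).mul_continuousAt_of_eq_zero (g := fun t => θ t - θ x) (by
          simp only [Pi.sub_apply]
          field_simp
          linear_combination (-1 : ℝ) * hx + R * hcs) (hθc.sub continuousAt_const)
    rw [sub_self, mul_zero] at this
    exact this
  have H3 : HasDerivAt (fun t => (θ t - θ x) ^ 2 * (A t * r₁ (θ t) - 2 * B t * r₂ (θ t))) 0 x := by
    have := hδ2.mul_continuousAt_of_eq_zero (by simp)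
      (g := fun t => A t * r₁ (θ t) - 2 * B t * r₂ (θ t))
      ((hA.continuousAt.mul (ContinuousAt.comp_of_eq (f := θ) hr₁ hθc rfl)).sub
        ((hB.continuousAt.const_mul 2).mul (ContinuousAt.comp_of_eq (f := θ) hr₂ hθc rfl)))
    rwa [zero_mul] at this
  refine (((((H1.add H2).add H3).const_mul (ω / 2)).div_const √2).congr_of_eventuallyEq
    (Eventually.of_forall fun t => ?_)).congr_deriv ?_
  · have e1 := e₁ (θ t)
    have e2 := e₂ (θ t)
    simp only [outerLength, Pi.add_apply]
    rw [show (Real.cos (ω * T t) * A t - 2 * B t) / Real.sin (ω * T t) =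
      A t * (Real.cos (θ t) * (Real.sin (θ t))⁻¹) - 2 * B t * (Real.sin (θ t))⁻¹ by
        simp only [hθ]; ring, e1, e2, hRdef]
    congr 1
    have : T t = θ t / ω := by simp only [hθ]; field_simp
    rw [this]
    field_simp
    ring
  · simp only [hθ]
    field_simp
    ring

/-! ### Harmonic arcs over a curve transversal to the rays -/

/-- A point on the chord direction between two points of a Lipschitz graph, pushed outwards by the
curvature of a harmonic arc, lies beyond the graph. -/
lemma one_le_of_harmonic_chord {t s a a₁ b b₁ ρ K c : ℝ} (ht : 0 < t) (hs : 0 < s)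
    (hid : t ^ 2 + s ^ 2 + 2 * t * s * c = 1) (hK : 0 ≤ K) (h8 : 8 * (K * |b₁|) ≤ 1 - c)
    (h4 : K * |b₁| ≤ 1 / 4) (e1 : s + t * (1 + a₁) = ρ * (1 + a)) (e2 : t * b₁ = ρ * b)
    (ha : |a| ≤ K * |b|) (ha₁ : |a₁| ≤ K * |b₁|) (haa : |a - a₁| ≤ K * |b - b₁|) (hρ : 0 < ρ) :
    1 ≤ ρ := by
  by_contra! hlt
  set κ := K * |b₁| with hκ
  have hκ0 : 0 ≤ κ := by positivity
  have hm : (t + s) ^ 2 = 1 + 2 * t * s * (1 - c) := by linear_combination hid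
  have hts : 0 < t * s := mul_pos ht hs
  have hm1 : 1 ≤ t + s := by
    by_contra! h
    nlinarith [mul_nonneg hts.le (show (0 : ℝ) ≤ 1 - c by linarith)]
  -- The Lipschitz graph costs at most `4 * κ * t` when compared with the endpoint `1`, and at most
  -- `4 * κ * s` when compared with the other endpoint.
  have hd1 : t + s - ρ ≤ 4 * κ * t := by
    have h1 : |ρ * a| ≤ κ * t := by
      calc |ρ * a| = ρ * |a| := by rw [abs_mul, abs_of_pos hρ]
        _ ≤ ρ * (K * |b|) := mul_le_mul_of_nonneg_left ha hρ.le
        _ = K * |ρ * b| := by rw [abs_mul, abs_of_pos hρ]; ring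
        _ = κ * t := by rw [← e2, abs_mul, abs_of_pos ht, hκ]; ring
    have h2 : |t * a₁| ≤ κ * t := by
      rw [abs_mul, abs_of_pos ht]
      nlinarith
    have h3 := abs_le.mp h1
    have h4 := abs_le.mp h2
    nlinarith [mul_nonneg hκ0 ht.le]
  have hd2 : t + s - ρ ≤ 4 * κ * s := by
    have h1 : |ρ * (a - a₁)| ≤ κ * (s + (t + s - ρ)) := by
      calc |ρ * (a - a₁)| = ρ * |a - a₁| := by rw [abs_mul, abs_of_pos hρ]
        _ ≤ ρ * (K * |b - b₁|) := mul_le_mul_of_nonneg_left haa hρ.le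
        _ = K * |ρ * (b - b₁)| := by rw [abs_mul, abs_of_pos hρ]; ring
        _ = κ * |t - ρ| := by rw [mul_sub, ← e2, ← sub_mul, abs_mul, hκ]; ring
        _ ≤ κ * (s + (t + s - ρ)) := by
          refine mul_le_mul_of_nonneg_left (abs_le.mpr ⟨by linarith, by linarith⟩) hκ0
    have h2 : |s * a₁| ≤ κ * s := by
      rw [abs_mul, abs_of_pos hs]
      nlinarith
    have h3 := abs_le.mp h1
    have h5 := abs_le.mp h2
    have h6 := abs_le.mp ha₁
    have h7 : (t + s - ρ) * (1 + a₁) ≤ 2 * κ * s + κ * (t + s - ρ) := by linarith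
    nlinarith
  -- By `hm`, `t + s - 1` is at least `(1 - c) / 2` times the smaller weight; with `8 * κ ≤ 1 - c`,
  -- the assumption `ρ < 1` would make it strictly less.
  rcases le_total t s with h | h
  · have h1 : t * (1 - c) ≤ 2 * (t + s - 1) := by
      nlinarith [mul_nonneg ht.le (show (0 : ℝ) ≤ 1 - c by linarith)]
    nlinarith
  · have h1 : s * (1 - c) ≤ 2 * (t + s - 1) := by
      nlinarith [mul_nonneg hs.le (show (0 : ℝ) ≤ 1 - c by linarith)]
    nlinarith

/-- The harmonic arc between two points of a curve transversal to the rays stays beyond it. -/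
lemma exists_ray_of_harmonic_chord {ζ : ℝ → ℂ} {x y t s c K : ℝ} (hζ : ContinuousOn ζ (uIcc x y))
    (hx : ζ x = 1) (hre : ∀ η ∈ uIcc x y, 0 < (ζ η).re)
    (hlip : ∀ η ∈ uIcc x y, ∀ η' ∈ uIcc x y,
      |(ζ η).re - (ζ η').re| ≤ K * |(ζ η).im - (ζ η').im|)
    (hK : 0 ≤ K) (ht : 0 < t) (hs : 0 < s) (hid : t ^ 2 + s ^ 2 + 2 * t * s * c = 1)
    (h8 : 8 * (K * |(ζ y).im|) ≤ 1 - c) (h4 : K * |(ζ y).im| ≤ 1 / 4) :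
    ∃ η ∈ uIcc x y, ∃ ρ : ℝ, 1 ≤ ρ ∧ (s : ℂ) + t * ζ y = ρ * ζ η := by
  have hxm : x ∈ uIcc x y := left_mem_uIcc
  have hym : y ∈ uIcc x y := right_mem_uIcc
  set zr := s + t * (ζ y).re with hzr
  set zi := t * (ζ y).im with hzi
  have hzrpos : 0 < zr := by
    have := hre y hym
    positivity
  have hcont : ContinuousOn (fun η => (ζ η).im * zr - (ζ η).re * zi) (uIcc x y) :=
    ((Complex.continuous_im.comp_continuousOn hζ).mul continuousOn_const).sub
      ((Complex.continuous_re.comp_continuousOn hζ).mul continuousOn_const)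
  have hvx : (ζ x).im * zr - (ζ x).re * zi = -(t * (ζ y).im) := by simp [hx, hzi]
  have hvy : (ζ y).im * zr - (ζ y).re * zi = s * (ζ y).im := by
    simp only [hzr, hzi]
    ring
  -- The cross product of `ζ η` with the chord point takes values of opposite sign (or zero) at the
  -- two ends, so the ray through that point meets the curve.
  obtain ⟨η, hη, h0⟩ : ∃ η ∈ uIcc x y, (ζ η).im * zr - (ζ η).re * zi = 0 := by
    have himg := intermediate_value_uIcc hcont
    have h0 : (0 : ℝ) ∈ uIcc ((ζ x).im * zr - (ζ x).re * zi) ((ζ y).im * zr - (ζ y).re * zi) := by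
      rw [hvx, hvy, mem_uIcc]
      rcases le_total 0 (ζ y).im with h | h
      · exact Or.inl ⟨by nlinarith, by positivity⟩
      · exact Or.inr ⟨by nlinarith, by nlinarith⟩
    exact himg h0
  have hreη := hre η hη
  have hρ : 0 < zr / (ζ η).re := div_pos hzrpos hreη
  have hre_eq : zr = zr / (ζ η).re * (ζ η).re := by field_simp
  have him_eq : zi = zr / (ζ η).re * (ζ η).im := by
    field_simp
    linear_combination (-1 : ℝ) * h0
  have e := hlip η hη x hxm
  have e₁ := hlip y hym x hxm
  have e₂ := hlip η hη y hym
  simp only [hx, Complex.one_re, Complex.one_im, sub_zero] at e e₁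
  refine ⟨η, hη, zr / (ζ η).re, ?_, ?_⟩
  · refine one_le_of_harmonic_chord (a := (ζ η).re - 1) (a₁ := (ζ y).re - 1) (b := (ζ η).im)
      ht hs hid hK h8 h4 ?_ him_eq e e₁ ?_ hρ
    · linear_combination hre_eq
    · rwa [sub_sub_sub_cancel_right]
  · apply Complex.ext
    · simpa using hre_eq
    · simpa using him_eq

/-! ### Continuity of the duration, and the radial arc -/

namespace RefractionBilliard

variable {B : RefractionBilliard}

lemma IsOuterVelocity.norm_le {ξ₁ ξ₂ T : ℝ} {v : ℂ} (h : B.IsOuterVelocity ξ₁ ξ₂ T v) :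
    ‖v‖ ≤ √(2 * B.ℰ) := by
  refine Real.le_sqrt_of_sq_le ?_
  have := h.energy
  nlinarith [mul_nonneg (sq_nonneg B.ω) (sq_nonneg ‖B.γ ξ₁‖)]

lemma IsOuterVelocity.dist_le {ξ₁ ξ₂ T : ℝ} {v : ℂ} (h : B.IsOuterVelocity ξ₁ ξ₂ T v) :
    ‖B.γ ξ₂ - B.γ ξ₁‖ ≤ √(2 * B.ℰ) * T := by
  have hvel : ∀ s, ‖harmonicVel B.ω (B.γ ξ₁) v s‖ ≤ √(2 * B.ℰ) := fun s => by
    refine Real.le_sqrt_of_sq_le ?_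
    rw [← h.energy, ← harmonic_energy B.ω_pos.ne' (B.γ ξ₁) v s]
    nlinarith [mul_nonneg (sq_nonneg B.ω) (sq_nonneg ‖harmonicArc B.ω (B.γ ξ₁) v s‖)]
  have := (convex_univ (𝕜 := ℝ) (E := ℝ)).norm_image_sub_le_of_norm_hasDerivWithin_le
    (fun s _ => (hasDerivAt_harmonicArc B.ω_pos.ne' (B.γ ξ₁) v s).hasDerivWithinAt)
    (fun s _ => hvel s) (mem_univ 0) (mem_univ T)
  rwa [h.endpoint, harmonicArc_zero, sub_zero, Real.norm_of_nonneg h.pos.le] at this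

/-- The duration of the outer arcs is continuous wherever it stays away from zero. -/
lemma continuousAt_outerTime {ξE ξ₀ δ : ℝ} {T : ℝ → ℝ} {v : ℝ → ℂ}
    (hξ₀ : ξ₀ ∈ Ioo 0 B.L) (hδ : 0 < δ) (hlow : ∀ᶠ ξ in 𝓝 ξ₀, δ ≤ T ξ)
    (hT : ∀ᶠ ξ in 𝓝 ξ₀, B.IsOuterVelocity ξE ξ (T ξ) (v ξ) ∧
      ∀ T' v', B.IsOuterVelocity ξE ξ T' v' → T' = T ξ ∧ v' = v ξ) :
    ContinuousAt T ξ₀ := by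
  refine (isCompact_Icc (a := δ) (b := 2 * Real.pi / B.ω)).tendsto_nhds_of_unique_mapClusterPt ?_ ?_
  · filter_upwards [hlow, hT] with ξ h1 h2
    exact ⟨h1, h2.1.time_le h2.2⟩
  intro y hy hcl
  -- Along an ultrafilter realising the cluster point the velocities, bounded by the energy,
  -- converge too. The complement of `D` is closed, so the limit is an outer arc and uniqueness
  -- identifies `y`.
  obtain ⟨U, hU, hTU⟩ := mapClusterPt_iff_ultrafilter.mp hcl
  have hTU' : ∀ᶠ ξ in U, B.IsOuterVelocity ξE ξ (T ξ) (v ξ) := hU (hT.mono fun _ h => h.1)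
  obtain ⟨v', -, hv'⟩ := (isCompact_closedBall (0 : ℂ) √(2 * B.ℰ)).ultrafilter_le_nhds' (U.map v)
    (by
      change ∀ᶠ ξ in U, v ξ ∈ Metric.closedBall (0 : ℂ) √(2 * B.ℰ)
      filter_upwards [hTU'] with ξ h
      simpa using h.norm_le)
  have hvU : Tendsto v U (𝓝 v') := hv'
  have hγ : Tendsto B.γ U (𝓝 (B.γ ξ₀)) := (B.hasDerivAt_γ hξ₀).continuousAt.tendsto.mono_left hU
  have hlim : ∀ (S : ℝ → ℝ) (s : ℝ), Tendsto S U (𝓝 s) →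
      Tendsto (fun ξ => harmonicArc B.ω (B.γ ξE) (v ξ) (S ξ)) U
        (𝓝 (harmonicArc B.ω (B.γ ξE) v' s)) := by
    intro S s hS
    have hω := hS.const_mul B.ω
    exact (((Real.continuous_cos.tendsto _).comp hω).smul_const _).add
      ((((Real.continuous_sin.tendsto _).comp hω).div_const _).smul hvU)
  refine (hT.self_of_nhds.2 y v' ⟨hδ.trans_le hy.1, ?_, fun s hs => ?_, ?_⟩).1
  · refine tendsto_nhds_unique (((hvU.norm.pow 2).add_const _)) ?_
    refine tendsto_const_nhds.congr' ?_
    filter_upwards [hTU'] with ξ h using h.energy.symm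
  · have hcl : IsClosed B.Dᶜ := B.isOpen_D.isClosed_compl
    refine hcl.mem_of_tendsto (hlim (fun _ => s) s tendsto_const_nhds) ?_
    filter_upwards [hTU', hTU.eventually_const_lt hs.2] with ξ h h'
    exact h.notMem s ⟨hs.1, h'⟩
  · refine tendsto_nhds_unique (hlim T y hTU) (hγ.congr' ?_)
    filter_upwards [hTU'] with ξ h using h.endpoint.symm

/-- The outer arc from a boundary point to itself is radial: the outward ray avoids the domain. -/
lemma ray_notMem {ξ : ℝ} (hξ : ξ ∈ Icc 0 B.L) (harc : ExistsUniqueArc (B.IsOuterArc ξ ξ))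
    (hna : ¬ B.Antipodal ξ ξ) :
    ‖B.γ ξ‖ < √(2 * B.ℰ) / B.ω ∧ ∀ ρ : ℝ, 1 ≤ ρ → ρ • B.γ ξ ∉ B.D := by
  have hω := B.ω_pos
  obtain ⟨T, v, hv, huniq⟩ := exists_unique_outerVelocity harc
  have hs := hv.sin_ne_zero huniq hna
  have hp := norm_pos_iff.mpr (B.γ_ne_zero hξ)
  have hT := hv.pos
  set x := B.ω * T / 2 with hx
  have h2x : B.ω * T = 2 * x := by rw [hx]; ring
  rw [h2x, Real.sin_two_mul] at hs
  have hsx : Real.sin x ≠ 0 := fun h => hs (by rw [h]; ring)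
  have hcx : Real.cos x ≠ 0 := fun h => hs (by rw [h]; ring)
  have hcs := Real.sin_sq_add_cos_sq x
  -- Equal endpoints and `sin (ω T) ≠ 0` leave only a radial velocity.
  have hveq : v = (B.ω * (Real.sin x / Real.cos x)) • B.γ ξ := by
    have hend := hv.endpoint
    rw [harmonicArc, h2x, Real.sin_two_mul, Real.cos_two_mul] at hend
    have h1 : v = (B.ω / (2 * Real.sin x * Real.cos x)) •
        ((2 * Real.sin x * Real.cos x / B.ω) • v) := by
      match_scalars
      field_simp
    rw [h1, eq_sub_of_add_eq' hend]
    match_scalars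
    field_simp
    linear_combination (-2 : ℝ) * hcs
  -- `F y = cos (ω y - x) / cos x`: the arc climbs until `T / 2` and comes back.
  set F : ℝ → ℝ := fun y => Real.cos (B.ω * y) + Real.sin x / Real.cos x * Real.sin (B.ω * y) with hF
  have harcF : ∀ y, harmonicArc B.ω (B.γ ξ) v y = F y • B.γ ξ := by
    intro y
    rw [harmonicArc, hveq]
    match_scalars
    field_simp
    simp only [hF]
    field_simp
  have hFc : Continuous F := by
    simp only [hF]
    fun_prop
  have hF0 : F 0 = 1 := by simp [hF]
  have hFne : ∀ y ∈ Ioo 0 T, F y ≠ 0 := by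
    intro y hy h0
    apply hv.notMem y hy
    rw [harcF, h0, zero_smul]
    exact B.zero_mem_D
  have hFT : F (T / 2) = 1 / Real.cos x := by
    simp only [hF]
    rw [show B.ω * (T / 2) = x by rw [hx]; ring]
    field_simp
    linear_combination hcs
  have hcpos : 0 < Real.cos x := by
    by_contra! h
    have h1 : F (T / 2) ≤ 0 := by
      rw [hFT]
      exact div_nonpos_of_nonneg_of_nonpos zero_le_one h
    obtain ⟨y, hy, hy0⟩ := intermediate_value_Icc' (by linarith : (0 : ℝ) ≤ T / 2)
      hFc.continuousOn (show (0 : ℝ) ∈ Icc (F (T / 2)) (F 0) from ⟨h1, by rw [hF0]; norm_num⟩)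
    refine hFne y ⟨lt_of_le_of_ne hy.1 ?_, by linarith [hy.2]⟩ hy0
    rintro rfl
    rw [hF0] at hy0
    exact one_ne_zero hy0
  -- By the energy the turning point lies on the Hill circle: the ray is swept by the arc up to
  -- there, and outside the ball containing `D` from there on.
  have hen : (‖B.γ ξ‖ / Real.cos x) ^ 2 = (√(2 * B.ℰ) / B.ω) ^ 2 := by
    have := hv.energy
    rw [hveq, norm_smul, mul_pow, Real.norm_eq_abs, sq_abs] at this
    rw [div_pow √(2 * B.ℰ), Real.sq_sqrt (by have := B.ℰ_pos; positivity)]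
    field_simp at this ⊢
    linear_combination this - B.ω ^ 2 * ‖B.γ ξ‖ ^ 2 * hcs
  have hRpos : 0 ≤ √(2 * B.ℰ) / B.ω := by positivity
  have hR : ‖B.γ ξ‖ / Real.cos x = √(2 * B.ℰ) / B.ω :=
    (sq_eq_sq₀ (by positivity) hRpos).mp hen
  have hclt : Real.cos x < 1 := by
    refine lt_of_le_of_ne (Real.cos_le_one x) fun h => hsx ?_
    rw [h] at hcs
    exact pow_eq_zero_iff (two_ne_zero) |>.mp (by linarith)
  refine ⟨?_, fun ρ hρ hmem => ?_⟩
  · rw [← hR, lt_div_iff₀ hcpos]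
    exact mul_lt_of_lt_one_right hp hclt
  have h1 := B.D_subset_hill hmem
  rw [Metric.mem_ball, dist_zero_right, norm_smul, Real.norm_of_nonneg (by linarith), ← hR,
    lt_div_iff₀ hcpos] at h1
  have h2 : ρ * Real.cos x < 1 := by
    by_contra! h
    nlinarith
  obtain ⟨y, hy, hyρ⟩ := intermediate_value_Icc (by linarith : (0 : ℝ) ≤ T / 2)
    hFc.continuousOn (show ρ ∈ Icc (F 0) (F (T / 2)) from ⟨by rw [hF0]; exact hρ, by
      rw [hFT, le_div_iff₀ hcpos]; exact h2.le⟩)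
  rcases hy.1.eq_or_lt with rfl | hy0
  · rw [← hyρ, hF0, one_smul] at hmem
    exact B.γ_notMem_D hξ hmem
  · apply hv.notMem y ⟨hy0, by linarith [hy.2]⟩
    rwa [harcF, hyρ]

end RefractionBilliard

/-! ### Outer arcs near the radial one, and the derivative of `S_E` -/

/-- Strict differentiability with a non-zero imaginary derivative makes the curve locally a
Lipschitz graph over the direction orthogonal to the ray. -/
lemma HasStrictDerivAt.eventually_abs_re_sub_le {ζ : ℝ → ℂ} {ζ' : ℂ} {x : ℝ}
    (hζ : HasStrictDerivAt ζ ζ' x) (him : ζ'.im ≠ 0) :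
    ∃ K, 0 ≤ K ∧ ∃ ε > 0, ∀ η ∈ Metric.ball x ε, ∀ η' ∈ Metric.ball x ε,
      |(ζ η).re - (ζ η').re| ≤ K * |(ζ η).im - (ζ η').im| := by
  have h1 : HasStrictDerivAt (fun η => (ζ η).im) ζ'.im x :=
    Complex.imCLM.hasStrictFDerivAt.comp_hasStrictDerivAt x hζ
  have h2 : HasStrictDerivAt (fun η => (ζ η).re) ζ'.re x :=
    Complex.reCLM.hasStrictFDerivAt.comp_hasStrictDerivAt x hζ
  have h3 := h2.hasStrictFDerivAt.isBigO_sub.trans (HasDerivAtFilter.isTheta_sub h1 him).isBigO_symm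
  obtain ⟨K, hK, hb⟩ := h3.exists_nonneg
  obtain ⟨ε, hε, hball⟩ := Metric.eventually_nhds_iff_ball.mp hb.bound
  refine ⟨K, hK, ε, hε, fun η hη η' hη' => ?_⟩
  have := hball (η, η') (by
    rw [← ball_prod_same]
    exact ⟨hη, hη'⟩)
  simpa [Real.norm_eq_abs] using this

/-- The initial velocity of the harmonic arc from `p` to `q` of phase `x`. -/
lemma harmonicArc_of_endpoints {ω x : ℝ} (hω : ω ≠ 0) (hs : Real.sin x ≠ 0) (p q : ℂ) (s : ℝ) :
    harmonicArc ω p ((ω / Real.sin x) • (q - Real.cos x • p)) s =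
      (Real.sin (x - ω * s) / Real.sin x) • p + (Real.sin (ω * s) / Real.sin x) • q := by
  rw [harmonicArc, Real.sin_sub]
  match_scalars
  · field_simp
    ring
  · field_simp

lemma sin_chord_identity (x φ : ℝ) :
    Real.sin φ ^ 2 + Real.sin (x - φ) ^ 2 + 2 * Real.sin φ * Real.sin (x - φ) * Real.cos x =
      Real.sin x ^ 2 := by
  rw [Real.sin_sub]
  have h1 := Real.sin_sq_add_cos_sq x
  have h2 := Real.sin_sq_add_cos_sq φ
  linear_combination Real.sin x ^ 2 * h2 - Real.sin φ ^ 2 * h1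

namespace RefractionBilliard

variable {B : RefractionBilliard}

/-- Near a boundary point where the boundary is transversal to the rays, there are outer arcs close
to the radial one. -/
lemma exists_outerVelocity_near {a b ξ₀ : ℝ} (hab : Ioo a b ⊆ Icc 0 B.L) (hξ₀ : ξ₀ ∈ Ioo a b)
    (hlt : ‖B.γ ξ₀‖ < √(2 * B.ℰ) / B.ω)
    (hrays : ∀ ξ ∈ Ioo a b, ∀ ρ : ℝ, 1 ≤ ρ → ρ • B.γ ξ ∉ B.D)
    (hrad : (deriv B.γ ξ₀ / B.γ ξ₀).im ≠ 0) :
    ∃ κ < (1 : ℝ), ∀ᶠ ξ in 𝓝 ξ₀, ∃ T v, B.IsOuterVelocity ξ₀ ξ T v ∧ Real.cos (B.ω * T) ≤ κ := by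
  have hω := B.ω_pos
  have hℰ := B.ℰ_pos
  have hξL := Ioo_subset_Ioo_of_subset_Icc hab hξ₀
  have hp0 := B.γ_ne_zero (hab hξ₀)
  have hp := norm_pos_iff.mpr hp0
  set R := 2 * B.ℰ / B.ω ^ 2 with hRdef
  have hR : 0 < R := by positivity
  have hpR : ‖B.γ ξ₀‖ ^ 2 < R := by
    have := pow_lt_pow_left₀ hlt (norm_nonneg _) two_ne_zero
    rwa [div_pow, Real.sq_sqrt (by positivity)] at this
  set ζ : ℝ → ℂ := fun η => B.γ η / B.γ ξ₀ with hζ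
  have hζγ : ∀ η, B.γ η = ζ η * B.γ ξ₀ := fun η => by
    simp only [hζ]
    field_simp
  have hζd : HasStrictDerivAt ζ (deriv B.γ ξ₀ / B.γ ξ₀) ξ₀ :=
    (B.hasStrictDerivAt_γ hξL).div_const _
  have hζc : ContinuousAt ζ ξ₀ := hζd.hasDerivAt.continuousAt
  have hζ1 : ζ ξ₀ = 1 := div_self hp0
  obtain ⟨K, hK, ε, hε, hlip⟩ := hζd.eventually_abs_re_sub_le hrad
  have hγc : ContinuousAt B.γ ξ₀ := (B.hasDerivAt_γ hξL).continuousAt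
  set disc : ℝ → ℝ := fun ξ => inner ℝ (B.γ ξ₀) (B.γ ξ) ^ 2 -
    R * (‖B.γ ξ₀‖ ^ 2 + ‖B.γ ξ‖ ^ 2 - R) with hdisc
  -- The smaller root of the quadratic for `cos (ω T)`. At `ξ₀` the larger root is `1`, the arc of
  -- zero duration, and the smaller one, `2 * ‖γ ξ₀‖ ^ 2 / R - 1`, belongs to the radial arc.
  set c : ℝ → ℝ := fun ξ => (inner ℝ (B.γ ξ₀) (B.γ ξ) - √(disc ξ)) / R with hc
  have hdiscc : ContinuousAt disc ξ₀ := by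
    simp only [hdisc]
    fun_prop
  have hcc : ContinuousAt c ξ₀ := by
    simp only [hc]
    fun_prop
  have hdisc0 : disc ξ₀ = (R - ‖B.γ ξ₀‖ ^ 2) ^ 2 := by
    simp only [hdisc, real_inner_self_eq_norm_sq]
    ring
  have hdiscpos : 0 < disc ξ₀ := by
    rw [hdisc0]
    have : 0 < R - ‖B.γ ξ₀‖ ^ 2 := by linarith
    positivity
  have hc0 : c ξ₀ = 2 * ‖B.γ ξ₀‖ ^ 2 / R - 1 := by
    simp only [hc]
    rw [hdisc0, Real.sqrt_sq (by linarith), real_inner_self_eq_norm_sq]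
    field_simp
    ring
  have hc1 : c ξ₀ < 1 := by
    rw [hc0, sub_lt_iff_lt_add, div_lt_iff₀ hR]
    linarith
  have hcm1 : -1 < c ξ₀ := by
    rw [hc0]
    have : 0 < 2 * ‖B.γ ξ₀‖ ^ 2 / R := by positivity
    linarith
  obtain ⟨κ, hκ0, hκ1⟩ := exists_between hc1
  refine ⟨κ, hκ1, ?_⟩
  have himc : ContinuousAt (fun ξ => K * |(ζ ξ).im|) ξ₀ :=
    (Complex.continuous_im.continuousAt.comp hζc).abs.const_mul K
  have him0 : K * |(ζ ξ₀).im| = 0 := by simp [hζ1]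
  have hE4 : ∀ᶠ ξ in 𝓝 ξ₀, K * |(ζ ξ).im| < 1 / 4 :=
    himc.eventually_lt continuousAt_const (by rw [him0]; norm_num)
  have hE8 : ∀ᶠ ξ in 𝓝 ξ₀, 8 * (K * |(ζ ξ).im|) < 1 - c ξ :=
    (himc.const_mul 8).eventually_lt (continuousAt_const.sub hcc) (by
      rw [him0]
      linarith)
  have hEre : ∀ᶠ ξ in 𝓝 ξ₀, 0 < (ζ ξ).re :=
    continuousAt_const.eventually_lt (Complex.continuous_re.continuousAt.comp hζc) (by
      simp [hζ1])
  have hEc : ∀ᶠ ξ in 𝓝 ξ₀, ContinuousAt ζ ξ := by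
    filter_upwards [isOpen_Ioo.mem_nhds hξL] with ξ hξ
    exact ((B.hasDerivAt_γ hξ).div_const _).continuousAt
  obtain ⟨r, hr, hball⟩ := Metric.eventually_nhds_iff_ball.mp
    ((hEre.and hEc).and (isOpen_Ioo.mem_nhds hξ₀))
  filter_upwards [hE4, hE8, hcc.eventually_lt continuousAt_const hκ0,
    continuousAt_const.eventually_lt hcc hcm1,
    continuousAt_const.eventually_lt hdiscc hdiscpos, Metric.ball_mem_nhds ξ₀ hε,
    Metric.ball_mem_nhds ξ₀ hr] with ξ h4 h8 hκ hm1 hd hξε hξr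
  have hquad : R * c ξ ^ 2 - 2 * inner ℝ (B.γ ξ₀) (B.γ ξ) * c ξ +
      (‖B.γ ξ₀‖ ^ 2 + ‖B.γ ξ‖ ^ 2 - R) = 0 := by
    have h1 : √(disc ξ) ^ 2 = disc ξ := Real.sq_sqrt hd.le
    have h2 : R * c ξ = inner ℝ (B.γ ξ₀) (B.γ ξ) - √(disc ξ) := by
      simp only [hc]
      field_simp
    have h3 : disc ξ = inner ℝ (B.γ ξ₀) (B.γ ξ) ^ 2 - R * (‖B.γ ξ₀‖ ^ 2 + ‖B.γ ξ‖ ^ 2 - R) := rfl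
    have h5 : R * (R * c ξ ^ 2 - 2 * inner ℝ (B.γ ξ₀) (B.γ ξ) * c ξ +
      (‖B.γ ξ₀‖ ^ 2 + ‖B.γ ξ‖ ^ 2 - R)) = 0 := by
      linear_combination (R * c ξ - inner ℝ (B.γ ξ₀) (B.γ ξ) - √(disc ξ)) * h2 + h1 + h3
    exact (mul_eq_zero_iff_left hR.ne').mp h5
  set x := Real.arccos (c ξ) with hx
  have hcx : Real.cos x = c ξ := Real.cos_arccos hm1.le (by linarith)
  have hx0 : 0 < x := Real.arccos_pos.mpr (by linarith)
  have hxpi : x < Real.pi := by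
    refine lt_of_le_of_ne (Real.arccos_le_pi _) fun h => ?_
    rw [h, Real.cos_pi] at hcx
    linarith
  have hsx : 0 < Real.sin x := Real.sin_pos_of_pos_of_lt_pi hx0 hxpi
  have hωT : B.ω * (x / B.ω) = x := by field_simp
  refine ⟨x / B.ω, (B.ω / Real.sin x) • (B.γ ξ - Real.cos x • B.γ ξ₀), ⟨by positivity, ?_, ?_, ?_⟩,
    by rw [hωT, hcx]; exact hκ.le⟩
  · have hsx2 := Real.sin_sq_add_cos_sq x
    rw [norm_smul, mul_pow, norm_sub_sq_real, norm_smul, real_inner_smul_right, mul_pow,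
      Real.norm_eq_abs, Real.norm_eq_abs, sq_abs, sq_abs, real_inner_comm, div_pow, hcx]
    rw [hcx] at hsx2
    have h1 : 2 * B.ℰ = R * B.ω ^ 2 := by
      rw [hRdef]
      field_simp
    rw [h1]
    field_simp
    linear_combination hquad + (‖B.γ ξ₀‖ ^ 2 - R) * hsx2
  · intro y hy
    have hφ0 : 0 < B.ω * y := mul_pos hω hy.1
    have hφx : B.ω * y < x := by
      have := mul_lt_mul_of_pos_left hy.2 hω
      rwa [hωT] at this
    have ht : 0 < Real.sin (B.ω * y) / Real.sin x :=
      div_pos (Real.sin_pos_of_pos_of_lt_pi hφ0 (by linarith)) hsx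
    have hs : 0 < Real.sin (x - B.ω * y) / Real.sin x :=
      div_pos (Real.sin_pos_of_pos_of_lt_pi (by linarith) (by linarith)) hsx
    have hsub : ∀ e : ℝ, ξ ∈ Metric.ball ξ₀ e → uIcc ξ₀ ξ ⊆ Metric.ball ξ₀ e := fun e he => by
      rw [← segment_eq_uIcc]
      exact (convex_ball ξ₀ e).segment_subset (Metric.mem_ball_self (dist_nonneg.trans_lt he)) he
    have hid : (Real.sin (B.ω * y) / Real.sin x) ^ 2 + (Real.sin (x - B.ω * y) / Real.sin x) ^ 2 +
        2 * (Real.sin (B.ω * y) / Real.sin x) * (Real.sin (x - B.ω * y) / Real.sin x) * c ξ = 1 := by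
      have := sin_chord_identity x (B.ω * y)
      rw [hcx] at this
      field_simp
      linear_combination this
    -- The point of the arc is `ρ ≥ 1` times a boundary point, hence on an outward ray that avoids
    -- `D`.
    obtain ⟨η, hη, ρ, hρ, heq⟩ := exists_ray_of_harmonic_chord (ζ := ζ) (x := ξ₀) (y := ξ) (K := K)
      (fun η hη => (hball η (hsub r hξr hη)).1.2.continuousWithinAt) hζ1
      (fun η hη => (hball η (hsub r hξr hη)).1.1)
      (fun η hη η' hη' => hlip η (hsub ε hξε hη) η' (hsub ε hξε hη')) hK ht hs hid h8.le h4.le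
    rw [harmonicArc_of_endpoints hω.ne' hsx.ne']
    have : (Real.sin (x - B.ω * y) / Real.sin x) • B.γ ξ₀ +
        (Real.sin (B.ω * y) / Real.sin x) • B.γ ξ = ρ • B.γ η := by
      rw [hζγ ξ, hζγ η]
      simp only [Complex.real_smul]
      linear_combination B.γ ξ₀ * heq
    rw [this]
    exact hrays η (hball η (hsub r hξr hη)).2 ρ hρ
  · rw [harmonicArc_of_endpoints hω.ne' hsx.ne', hωT, sub_self, Real.sin_zero, zero_div, zero_smul,
      zero_add, div_self hsx.ne', one_smul]

/-- The partial derivative of the outer length exists wherever the boundary is transversal to the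
rays, and is bounded by the square root of the energy. -/
lemma SE_differentiableAt {a b ξE ξ₀ : ℝ} (hab : Ioo a b ⊆ Icc 0 B.L)
    (hout : B.OuterArcProperty a b) (hna : B.NotAntipodal a b a b) (hξE : ξE ∈ Ioo a b)
    (hξ₀ : ξ₀ ∈ Ioo a b) (hrad : (deriv B.γ ξ₀ / B.γ ξ₀).im ≠ 0) :
    DifferentiableAt ℝ (fun x => B.SE ξE x) ξ₀ ∧ |B.dbSE ξE ξ₀| ≤ √B.ℰ := by
  have hω := B.ω_pos
  have hℰ := B.ℰ_pos
  have hξL := Ioo_subset_Ioo_of_subset_Icc hab hξ₀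
  have hex : ∀ ξ, ∃ T v, ξ ∈ Ioo a b → B.IsOuterVelocity ξE ξ T v ∧
      ∀ T' v', B.IsOuterVelocity ξE ξ T' v' → T' = T ∧ v' = v := by
    intro ξ
    by_cases hξ : ξ ∈ Ioo a b
    · obtain ⟨T, v, h⟩ := exists_unique_outerVelocity (hout ξE hξE ξ hξ)
      exact ⟨T, v, fun _ => h⟩
    · exact ⟨0, 0, fun h => absurd h hξ⟩
  choose T v hTv using hex
  have hmem : ∀ᶠ ξ in 𝓝 ξ₀, ξ ∈ Ioo a b := isOpen_Ioo.mem_nhds hξ₀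
  have hγc : ContinuousAt B.γ ξ₀ := (B.hasDerivAt_γ hξL).continuousAt
  -- Distinct ends keep `T` away from `0` because the speed is at most `√(2 * ℰ)`. For merging ends,
  -- uniqueness identifies the arcs with those near the radial one, whose cosine stays below `κ <
  -- 1`.
  have hlow : ∃ δ > 0, ∀ᶠ ξ in 𝓝 ξ₀, δ ≤ T ξ := by
    by_cases hne : B.γ ξ₀ = B.γ ξE
    · have hLt : ξE = ξ₀ := by
        have h1 := Ioo_subset_Ioo_of_subset_Icc hab hξE
        exact B.γ_simple (Ioo_subset_Ico_self h1) (Ioo_subset_Ico_self hξL) hne.symm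
      subst hLt
      have hrays := fun ξ (hξ : ξ ∈ Ioo a b) =>
        ray_notMem (hab hξ) (hout ξ hξ ξ hξ) (hna ξ hξ ξ hξ)
      obtain ⟨κ, hκ, hnear⟩ := exists_outerVelocity_near hab hξ₀ (hrays ξE hξ₀).1
        (fun ξ hξ => (hrays ξ hξ).2) hrad
      have hcos : ∀ᶠ t : ℝ in 𝓝 0, κ < Real.cos (B.ω * t) := by
        have hc : ContinuousAt (fun t : ℝ => Real.cos (B.ω * t)) 0 := by fun_prop
        exact continuousAt_const.eventually_lt hc (by simpa using hκ)
      obtain ⟨δ, hδ, hball⟩ := Metric.eventually_nhds_iff_ball.mp hcos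
      refine ⟨δ, hδ, ?_⟩
      filter_upwards [hnear, hmem] with ξ ⟨T', v', h1, h2⟩ hξ
      obtain ⟨rfl, -⟩ := (hTv ξ hξ).2 _ _ h1
      by_contra! hlt
      have := hball (T ξ) (by
        rw [Metric.mem_ball, Real.dist_0_eq_abs, abs_of_pos h1.pos]
        exact hlt)
      linarith
    · have hd : 0 < ‖B.γ ξ₀ - B.γ ξE‖ := norm_pos_iff.mpr (sub_ne_zero.mpr hne)
      have hsq : 0 < √(2 * B.ℰ) := by positivity
      refine ⟨‖B.γ ξ₀ - B.γ ξE‖ / 2 / √(2 * B.ℰ), by positivity, ?_⟩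
      have hev : ∀ᶠ ξ in 𝓝 ξ₀, ‖B.γ ξ₀ - B.γ ξE‖ / 2 < ‖B.γ ξ - B.γ ξE‖ :=
        continuousAt_const.eventually_lt (hγc.sub continuousAt_const).norm (by linarith)
      filter_upwards [hev, hmem] with ξ h1 hξ
      rw [div_le_iff₀ hsq, mul_comm]
      exact h1.le.trans (hTv ξ hξ).1.dist_le
  obtain ⟨δ, hδ, hlow⟩ := hlow
  have hTc : ContinuousAt T ξ₀ := continuousAt_outerTime (v := v) hξL hδ hlow
    (hmem.mono fun ξ hξ => hTv ξ hξ)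
  have hγd := B.hasDerivAt_γ hξL
  have hA : HasDerivAt (fun ξ => ‖B.γ ξE‖ ^ 2 + ‖B.γ ξ‖ ^ 2)
      (2 * inner ℝ (B.γ ξ₀) (deriv B.γ ξ₀)) ξ₀ := hγd.norm_sq.const_add _
  have hB : HasDerivAt (fun ξ => inner ℝ (B.γ ξE) (B.γ ξ))
      (inner ℝ (B.γ ξE) (deriv B.γ ξ₀)) ξ₀ := by
    refine ((hasDerivAt_const ξ₀ (B.γ ξE)).inner ℝ hγd).congr_deriv ?_
    simp
  have hs := (hTv ξ₀ hξ₀).1.sin_ne_zero (hTv ξ₀ hξ₀).2 (hna ξE hξE ξ₀ hξ₀)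
  have hlen := outerLength_hasDerivAt hω hℰ hA hB hTc
    (hmem.mono fun ξ hξ => (hTv ξ hξ).1.quadratic) hs
  have hSE : HasDerivAt (fun x => B.SE ξE x) _ ξ₀ := hlen.congr_of_eventuallyEq
    (hmem.mono fun ξ hξ => SE_eq (hout ξE hξE ξ hξ) (hna ξE hξE ξ hξ) (hTv ξ hξ).1)
  refine ⟨hSE.differentiableAt, ?_⟩
  rw [dbSE, hSE.deriv]
  have hquad := (hTv ξ₀ hξ₀).1.quadratic
  have hcs := Real.sin_sq_add_cos_sq (B.ω * T ξ₀)
  generalize Real.cos (B.ω * T ξ₀) = c at *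
  generalize Real.sin (B.ω * T ξ₀) = s at *
  have hin : c * (2 * inner ℝ (B.γ ξ₀) (deriv B.γ ξ₀)) - 2 * inner ℝ (B.γ ξE) (deriv B.γ ξ₀) =
      2 * inner ℝ (c • B.γ ξ₀ - B.γ ξE) (deriv B.γ ξ₀) := by
    rw [inner_sub_left, real_inner_smul_left]
    ring
  have hcauchy := abs_real_inner_le_norm (c • B.γ ξ₀ - B.γ ξE) (deriv B.γ ξ₀)
  rw [B.norm_deriv_γ_eq_one hξL, mul_one] at hcauchy
  -- `ω (c γ ξ₀ - γ ξE) / s` is the final velocity, whose square the energy bounds by `2 * ℰ`.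
  have hnorm : (B.ω * ‖c • B.γ ξ₀ - B.γ ξE‖) ^ 2 ≤ 2 * B.ℰ * s ^ 2 := by
    rw [mul_pow, norm_sub_sq_real, norm_smul, real_inner_smul_left, mul_pow, Real.norm_eq_abs,
      sq_abs, real_inner_comm]
    have h1 : 0 ≤ B.ω ^ 2 * s ^ 2 * ‖B.γ ξ₀‖ ^ 2 := by positivity
    refine le_of_eq_of_le (b := 2 * B.ℰ * s ^ 2 - B.ω ^ 2 * s ^ 2 * ‖B.γ ξ₀‖ ^ 2) ?_ (by linarith)
    linear_combination hquad + (B.ω ^ 2 * ‖B.γ ξ₀‖ ^ 2 - 2 * B.ℰ) * hcs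
  refine abs_le_of_sq_le_sq ?_ (Real.sqrt_nonneg _)
  rw [Real.sq_sqrt hℰ.le, hin]
  have h2 : √2 ^ 2 = (2 : ℝ) := Real.sq_sqrt (by norm_num)
  have hI := pow_le_pow_left₀ (abs_nonneg _) hcauchy 2
  rw [sq_abs] at hI
  have hs2 : 0 < s ^ 2 := by positivity
  have h3 : (B.ω / 2 * (2 * inner ℝ (c • B.γ ξ₀ - B.γ ξE) (deriv B.γ ξ₀) / s) / √2) ^ 2 =
      B.ω ^ 2 * inner ℝ (c • B.γ ξ₀ - B.γ ξE) (deriv B.γ ξ₀) ^ 2 / (2 * s ^ 2) := by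
    rw [div_pow, h2]
    field_simp
  rw [h3, div_le_iff₀ (by positivity)]
  nlinarith [mul_le_mul_of_nonneg_left hI (sq_nonneg B.ω)]

/-! ### Choice of the parameters and conclusion -/

/-- The Euclidean change-sign property yields parameters at which the boundary is transversal both
to the rays and to the circles centred at the origin. -/
lemma exists_transversal_pair {a b α β : ℝ} (hab : Ioo a b ⊆ Icc 0 B.L) (ha : a < α) (hαβ : α < β)
    (hb : β < b)
    (hcos : Real.cos (B.tangentAngle α) * Real.cos (B.tangentAngle β) < 0) :
    ∃ α' β', a < α' ∧ α' < β' ∧ β' < b ∧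
      inner ℝ (B.γ α') (deriv B.γ α') * inner ℝ (B.γ β') (deriv B.γ β') < 0 ∧
      (deriv B.γ α' / B.γ α').im ≠ 0 ∧ (deriv B.γ β' / B.γ β').im ≠ 0 := by
  have hL := Ioo_subset_Ioo_of_subset_Icc hab
  set f : ℝ → ℝ := fun ξ => inner ℝ (B.γ ξ) (deriv B.γ ξ) with hf
  have hsub : Icc α β ⊆ Ioo a b := Icc_subset_Ioo ha hb
  have hγc : ContinuousOn B.γ (Icc α β) := B.contDiffOn_γ.continuousOn.mono (hsub.trans hab)
  have hγ'c : ContinuousOn (deriv B.γ) (Icc α β) :=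
    ((B.contDiffOn_γ.mono Ioo_subset_Icc_self).continuousOn_deriv_of_isOpen isOpen_Ioo le_rfl).mono
      (hsub.trans hL)
  have hfc : ContinuousOn f (Icc α β) := hγc.inner hγ'c
  have hfab : f α * f β < 0 := by
    have hfe : ∀ ξ ∈ Icc α β, f ξ = Real.cos (B.tangentAngle ξ) * ‖B.γ ξ‖ := fun ξ hξ => by
      have := InnerProductGeometry.cos_angle_mul_norm_mul_norm (B.γ ξ) (deriv B.γ ξ)
      rw [B.norm_deriv_γ_eq_one (hL (hsub hξ)), mul_one] at this
      exact this.symm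
    have h1 := norm_pos_iff.mpr (B.γ_ne_zero (hab (hsub (left_mem_Icc.mpr hαβ.le))))
    have h2 := norm_pos_iff.mpr (B.γ_ne_zero (hab (hsub (right_mem_Icc.mpr hαβ.le))))
    rw [hfe α (left_mem_Icc.mpr hαβ.le), hfe β (right_mem_Icc.mpr hαβ.le)]
    nlinarith [mul_pos h1 h2]
  obtain ⟨δ, hδ, hlow⟩ : ∃ δ > 0, ∀ ξ ∈ Icc α β, δ ≤ ‖B.γ ξ‖ :=
    isCompact_Icc.exists_forall_le' hγc.norm fun ξ hξ =>
      norm_pos_iff.mpr (B.γ_ne_zero (hab (hsub hξ)))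
  -- A radial unit tangent would give `|f ξ| = ‖γ ξ‖ ≥ δ`.
  have htrans : ∀ ξ ∈ Icc α β, |f ξ| < δ → (deriv B.γ ξ / B.γ ξ).im ≠ 0 := by
    intro ξ hξ hlt him
    have hne := B.γ_ne_zero (hab (hsub hξ))
    have hre : deriv B.γ ξ = (deriv B.γ ξ / B.γ ξ).re • B.γ ξ := by
      rw [Complex.real_smul, show (((deriv B.γ ξ / B.γ ξ).re : ℝ) : ℂ) = deriv B.γ ξ / B.γ ξ from
        Complex.ext (by simp) (by simp [him])]
      field_simp
    have hn := B.norm_deriv_γ_eq_one (hL (hsub hξ))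
    have hfξ : f ξ = (deriv B.γ ξ / B.γ ξ).re * ‖B.γ ξ‖ ^ 2 := by
      simp only [hf]
      conv_lhs => rw [hre]
      rw [real_inner_smul_right, real_inner_self_eq_norm_sq]
    rw [hre, norm_smul, Real.norm_eq_abs] at hn
    have : |f ξ| = ‖B.γ ξ‖ := by
      rw [hfξ, abs_mul, abs_of_nonneg (sq_nonneg ‖B.γ ξ‖), pow_two, ← mul_assoc, hn, one_mul]
    linarith [hlow ξ hξ]
  obtain ⟨ε, hε, hεδ, hεα, hεβ⟩ : ∃ ε > 0, ε < δ ∧ ε < |f α| ∧ ε < |f β| := by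
    have h1 : f α ≠ 0 := fun h => by simp [h] at hfab
    have h2 : f β ≠ 0 := fun h => by simp [h] at hfab
    have hm : 0 < min δ (min |f α| |f β|) := by positivity
    obtain ⟨ε, h3, h4⟩ := exists_between hm
    exact ⟨ε, h3, h4.trans_le (min_le_left _ _),
      h4.trans_le ((min_le_right _ _).trans (min_le_left _ _)),
      h4.trans_le ((min_le_right _ _).trans (min_le_right _ _))⟩
  -- The sign `σ` reduces to `σ * f` positive at `α`. The levels `ε` and `-ε` are then sought on
  -- either side of a zero, which orders `α'` and `β'`.
  obtain ⟨σ, hσ, hgα, hgβ⟩ : ∃ σ : ℝ, σ ^ 2 = 1 ∧ ε < σ * f α ∧ σ * f β < -ε := by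
    rcases mul_neg_iff.mp hfab with ⟨h1, h2⟩ | ⟨h1, h2⟩
    · rw [abs_of_pos h1] at hεα
      rw [abs_of_neg h2] at hεβ
      exact ⟨1, by norm_num, by linarith, by linarith⟩
    · rw [abs_of_neg h1] at hεα
      rw [abs_of_pos h2] at hεβ
      exact ⟨-1, by norm_num, by linarith, by linarith⟩
  have hgc : ContinuousOn (fun ξ => σ * f ξ) (Icc α β) := hfc.const_mul σ
  have habs : ∀ ξ, |σ * f ξ| = |f ξ| := fun ξ => by
    rw [abs_mul, show |σ| = 1 by rw [← sq_eq_sq₀ (abs_nonneg σ) zero_le_one, sq_abs, hσ, one_pow], one_mul]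
  obtain ⟨c, hc, hgc0⟩ := intermediate_value_Icc' hαβ.le hgc
    (show (0 : ℝ) ∈ Icc _ _ from ⟨by linarith, by linarith⟩)
  obtain ⟨α', hα', hgα'⟩ := intermediate_value_Icc' hc.1 (hgc.mono (Icc_subset_Icc_right hc.2))
    (show ε ∈ Icc _ _ from ⟨hgc0.le.trans hε.le, hgα.le⟩)
  obtain ⟨β', hβ', hgβ'⟩ := intermediate_value_Icc' hc.2 (hgc.mono (Icc_subset_Icc_left hc.1))
    (show -ε ∈ Icc _ _ from ⟨hgβ.le, (neg_nonpos.mpr hε.le).trans hgc0.ge⟩)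
  have hα'm : α' ∈ Icc α β := ⟨hα'.1, hα'.2.trans hc.2⟩
  have hβ'm : β' ∈ Icc α β := ⟨hc.1.trans hβ'.1, hβ'.2⟩
  simp only at hgα' hgβ'
  refine ⟨α', β', ha.trans_le hα'.1, lt_of_le_of_ne (hα'.2.trans hβ'.1) ?_, hβ'.2.trans_lt hb, ?_,
    htrans α' hα'm ?_, htrans β' hβ'm ?_⟩
  · rintro rfl
    linarith
  · change f α' * f β' < 0
    have h1 : f α' * f β' = -ε ^ 2 := by
      linear_combination (-(f α' * f β')) * hσ + σ * f β' * hgα' + ε * hgβ'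
    rw [h1]
    have : 0 < ε ^ 2 := by positivity
    linarith
  · rw [← habs, hgα', abs_of_pos hε]
    exact hεδ
  · rw [← habs, hgβ', abs_neg, abs_of_pos hε]
    exact hεδ

end RefractionBilliard

theorem mainTheorem8 (B : RefractionBilliard) (m : ℕ) (a b : Fin m → ℝ)
    (hA : B.EuclideanChangeSignProperty a b) : B.ChangeSignProperty a b := by
  obtain ⟨hin, hout, α₀, β₀, hαβ₀, hcos⟩ := hA
  refine ⟨hin, hout, ?_⟩
  obtain ⟨h₀, hh₀, harcs⟩ := hin.arcs
  refine ⟨h₀, hh₀, harcs, ?_⟩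
  choose α β ha hαβ hb hf hα hβ using fun i =>
    RefractionBilliard.exists_transversal_pair (hin.subset i) (hαβ₀ i).1 (hαβ₀ i).2.1 (hαβ₀ i).2.2
      (hcos i)
  have hsub : ∀ i, Icc (α i) (β i) ⊆ Ioo (a i) (b i) := fun i => Icc_subset_Ioo (ha i) (hb i)
  have hself : ∀ i, B.NotAntipodal (a i) (b i) (a i) (b i) := fun i => by
    obtain ⟨j, -, h, -⟩ := hin.not_antipodal i
    exact h
  have hαm : ∀ i, α i ∈ Ioo (a i) (b i) := fun i => hsub i (left_mem_Icc.mpr (hαβ i).le)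
  have hβm : ∀ i, β i ∈ Ioo (a i) (b i) := fun i => hsub i (right_mem_Icc.mpr (hαβ i).le)
  have hev : ∀ ξ : Fin m → ℝ, (∀ i, ξ i ∈ Ioo (a i) (b i)) →
      (∀ i, inner ℝ (B.γ (ξ i)) (deriv B.γ (ξ i)) ≠ 0) →
      ∀ᶠ h in atTop, ∀ i, ∀ j, j ∈ B.NA a b i → ∀ ξI ∈ Icc (α j) (β j),
        DifferentiableAt ℝ (fun x => B.SI h x ξI) (ξ i) ∧
        (0 < inner ℝ (B.γ (ξ i)) (deriv B.γ (ξ i)) → √B.ℰ < B.daSI h (ξ i) ξI) ∧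
        (inner ℝ (B.γ (ξ i)) (deriv B.γ (ξ i)) < 0 → B.daSI h (ξ i) ξI < -√B.ℰ) := by
    intro ξ hξ hne
    refine eventually_all.mpr fun i => eventually_all.mpr fun j => ?_
    by_cases hj : j ∈ B.NA a b i
    · filter_upwards [B.eventually_daSI_sign (hin.subset i) (hin.subset j) hj (hξ i) (hsub j)
        (harcs i j hj) (hne i)] with h hh _ using hh
    · exact Eventually.of_forall fun h hj' => absurd hj' hj
  have hfα : ∀ i, inner ℝ (B.γ (α i)) (deriv B.γ (α i)) ≠ 0 := fun i h => by
    have := hf i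
    rw [h, zero_mul] at this
    exact lt_irrefl _ this
  have hfβ : ∀ i, inner ℝ (B.γ (β i)) (deriv B.γ (β i)) ≠ 0 := fun i h => by
    have := hf i
    rw [h, mul_zero] at this
    exact lt_irrefl _ this
  obtain ⟨h₁, hh₁⟩ := eventually_atTop.mp ((hev α hαm hfα).and (hev β hβm hfβ))
  refine ⟨max h₁ h₀, le_max_right _ _, α, β, fun i => ⟨ha i, hαβ i, hb i⟩, ?_⟩
  intro h hh i ξE hξE j hj ξI hξI
  obtain ⟨hhα, hhβ⟩ := hh₁ h ((le_max_left _ _).trans hh.le)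
  obtain ⟨dα, pα, nα⟩ := hhα i j hj ξI hξI
  obtain ⟨dβ, pβ, nβ⟩ := hhβ i j hj ξI hξI
  obtain ⟨eα, bα⟩ := RefractionBilliard.SE_differentiableAt (hin.subset i) (hout i) (hself i)
    (hsub i hξE) (hαm i) (hα i)
  obtain ⟨eβ, bβ⟩ := RefractionBilliard.SE_differentiableAt (hin.subset i) (hout i) (hself i)
    (hsub i hξE) (hβm i) (hβ i)
  refine ⟨⟨eα, dα⟩, ⟨eβ, dβ⟩, ?_⟩
  rw [abs_le] at bα bβ
  -- Each sum has the sign of its inner term, whose modulus exceeds the bound `√ℰ` for the outer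
  -- one.
  rcases mul_neg_iff.mp (hf i) with ⟨h1, h2⟩ | ⟨h1, h2⟩
  · exact mul_neg_of_pos_of_neg (by linarith [pα h1]) (by linarith [nβ h2])
  · exact mul_neg_of_neg_of_pos (by linarith [nα h1]) (by linarith [pβ h2])
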